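/- Let $A=\mathbb{C}[X]$ with $\partial=d/dX$. A differential module is a finitely generated $A$-module $P$ with an additive map $\partial:P\to P$ such that $\partial(ap)=a'p+a\,\partial p$; such a $P$ is free over $A$. Morphisms are the $A$-linear maps commuting with $\partial$, $T_P$ denotes the ring of endomorphisms of $P$, and $P^*=\mathrm{Hom}_A(P,A)$ and $P\otimes_A Q$ carry the usual differentials, $(\partial\varphi)(p)=(\varphi(p))'-\varphi(\partial p)$ and $\partial(p\otimes q)=\partial p\otimes q+p\otimes\partial q$. Let $U^\circ$ be the quotient of $\bigoplus_P P^*\otimes_{T_P}P$ ($P$ running through the differential modules) by the subspace spanned by all $\psi\otimes t(p)-(\psi\circ t)\otimes p$ with $t:P\to Q$ a morphism, $\psi\in Q^*$, $p\in P$; write $[\varphi\otimes p]$ for the class of $\varphi\otimes p$. Then $(A,U^\circ)$ is a commutative Hopf algebroid over $\mathbb{C}$ with $$[\varphi\otimes p]\,[\psi\otimes q]=[(\psi\star\varphi)\otimes(q\otimes p)],\quad (\psi\star\varphi)(y\otimes x)=\psi(y)\varphi(x),\quad \mathsf{s}(a)=[a\,\mathrm{id}_A\otimes 1],\quad \mathsf{t}(a)=[\mathrm{id}_A\otimes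 a],$$ $$\varepsilon[\varphi\otimes p]=\varphi(p),\quad \Delta[\varphi\otimes p]=\sum_i[\varphi\otimes f_i]\otimes_A[f_i^*\otimes p],\quad S[\varphi\otimes p]=[\mathrm{ev}_p\otimes\varphi],$$ where $(f_i)$ is a basis of $P$ with dual basis $(f_i^*)$, and $\otimes_A$ is taken with respect to $\mathsf{t}$ on the left and $\mathsf{s}$ on the right factor. Let $M$ be a differential module with basis $e_1,\dots,e_m$ and dual basis $e_1^*,\dots,e_m^*$. Put $u_{ij}=[e_i^*\otimes e_j]$ and $\det_M=\det(u_{ij})$, which is invertible in $U^\circ$. Let $U^\circ_{(M)}\subseteq U^\circ$ be the $(A\otimes_{\mathbb{C}}A)$-subalgebra generated by all $[\varphi\otimes p]$ with $\varphi\in M^*$, $p\in M$, and by $\det_M^{-1}$; it is a Hopf subalgebroid of $(A,U^\circ)$. The differential Galois groupoid $\mathscr{H}_M(\mathbb{C})$ is the character groupoid of $(A,U^\circ_{(M)})$: its objects are the $\mathbb{C}$-algebra maps $x:A\to\mathbb{C}$ (the points $x(X)$ of $\mathbb{A}^1$), its arrows are the $\mathbb{C}$-algebra maps $g:U^\circ_{(M)}\to\mathbb{C}$,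 with source $g\circ\mathsf{t}$ and target $g\circ\mathsf{s}$; the composite of $f:x\to y$ followed by $g:y\to z$ is $h\mapsto \sum g(h_{(1)})f(h_{(2)})$, the identity at $x$ is $x\circ\varepsilon$, and the inverse of $g$ is $g\circ S$. Let $\mathscr{G}^m=\mathbb{A}^1\times GL_m(\mathbb{C})\times\mathbb{A}^1$ be the groupoid over $\mathbb{A}^1=\mathbb{C}$ with source $\mathrm{pr}_3$, target $\mathrm{pr}_1$ and $(x,a,y)(y,b,z)=(x,ab,z)$ (the pullback of $GL_m(\mathbb{C})$ along $\mathbb{A}^1\to\{*\}$). Let $(A,(A\otimes_{\mathbb{C}}A)[X_{ij},\det^{-1}])$ be the Hopf algebroid with $\mathsf{s}(a)=a\otimes1$, $\mathsf{t}(a)=1\otimes a$, $\Delta(X_{ij})=\sum_k X_{ik}\otimes_A X_{kj}$, $\varepsilon(X_{ij})=\delta_{ij}$, $S(X_{ij})=((X_{kl})^{-1})_{ij}$. **Corollary.** There is a surjective morphism of Hopf algebroids over $A$ $$\Phi_M:(A\otimes_{\mathbb{C}}A)[X_{ij},\det{}^{-1}]\longrightarrow U^\circ_{(M)},\qquad X_{ij}\longmapsto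 u_{ij}=[e_i^*\otimes e_j],$$ and it induces an embedding of groupoids $F:\mathscr{H}_M(\mathbb{C})\hookrightarrow\mathscr{G}^m$: the assignments $x\mapsto x(X)$ on objects and $g\mapsto\big(g(\mathsf{s}(X)),\,(g(\Phi_M(X_{ij})))_{ij},\,g(\mathsf{t}(X))\big)$ on arrows define a functor, which is bijective on objects and injective on arrows. For every object $x$ of $\mathscr{H}_M(\mathbb{C})$, $F$ restricts to an isomorphism of the isotropy group of $x$ onto a Zariski closed subgroup of $GL_m(\mathbb{C})$. -/

import Mathlib

open scoped TensorProduct Polynomial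

noncomputable section

namespace DiffGalois

section Amalgam

variable {k A B C R : Type*} [CommRing k] [CommRing A] [CommRing B] [CommRing C] [CommRing R]
  [Algebra k A] [Algebra k B] [Algebra k C] [Algebra k R]

/-- The ring `B`, regarded as an `A`-algebra through the homomorphism `f : A → B`. -/
@[nolint unusedArguments]
def Via (_f : A →ₐ[k] B) : Type _ := B

instance (f : A →ₐ[k] B) : CommRing (Via f) := inferInstanceAs (CommRing B)
instance (f : A →ₐ[k] B) : Algebra k (Via f) := inferInstanceAs (Algebra k B)
instance (f : A →ₐ[k] B) : Algebra A (Via f) := f.toRingHom.toAlgebra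
instance (f : A →ₐ[k] B) : IsScalarTower k A (Via f) :=
  IsScalarTower.of_algebraMap_eq (fun r => (f.commutes r).symm)

/-- The tensor product `B ⊗[A] C`, where `A` acts on `B` through `f` and on `C` through `g`. -/
def Amalg (f : A →ₐ[k] B) (g : A →ₐ[k] C) : Type _ := Via f ⊗[A] Via g

instance (f : A →ₐ[k] B) (g : A →ₐ[k] C) : CommRing (Amalg f g) :=
  inferInstanceAs (CommRing (Via f ⊗[A] Via g))
instance (f : A →ₐ[k] B) (g : A →ₐ[k] C) : Algebra k (Amalg f g) :=
  inferInstanceAs (Algebra k (Via f ⊗[A] Via g))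

namespace Amalg

/-- `b ↦ b ⊗ 1`. -/
def inl (f : A →ₐ[k] B) (g : A →ₐ[k] C) : B →ₐ[k] Amalg f g :=
  (Algebra.TensorProduct.includeLeft : Via f →ₐ[k] Via f ⊗[A] Via g)

/-- `c ↦ 1 ⊗ c`. -/
def inr (f : A →ₐ[k] B) (g : A →ₐ[k] C) : C →ₐ[k] Amalg f g :=
  ((Algebra.TensorProduct.includeRight : Via g →ₐ[A] Via f ⊗[A] Via g).restrictScalars k)

/-- `b ⊗ c`. -/
def tmul (f : A →ₐ[k] B) (g : A →ₐ[k] C) (b : Via f) (c : Via g) : Amalg f g :=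
  TensorProduct.tmul A b c

theorem tmul_eq (f : A →ₐ[k] B) (g : A →ₐ[k] C) (b : Via f) (c : Via g) :
    tmul f g b c = inl f g b * inr f g c := by
  refine Eq.symm ((Algebra.TensorProduct.tmul_mul_tmul (R := A) (A := Via f) (B := Via g)
    b 1 1 c).trans ?_)
  rw [mul_one, one_mul]; rfl

theorem induction {f : A →ₐ[k] B} {g : A →ₐ[k] C} {P : Amalg f g → Prop} (x : Amalg f g)
    (h0 : P 0) (hadd : ∀ x y, P x → P y → P (x + y)) (h : ∀ b c, P (inl f g b * inr f g c)) :
    P x := by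
  refine TensorProduct.induction_on (motive := P) x h0 (fun b c => ?_) hadd
  have := h b c
  rw [← tmul_eq] at this
  exact this

theorem glue (f : A →ₐ[k] B) (g : A →ₐ[k] C) : (inl f g).comp f = (inr f g).comp g := by
  ext a
  exact ((Algebra.TensorProduct.includeLeft : Via f →ₐ[A] Via f ⊗[A] Via g).commutes a).trans
    ((Algebra.TensorProduct.includeRight : Via g →ₐ[A] Via f ⊗[A] Via g).commutes a).symm

theorem glue_apply (f : A →ₐ[k] B) (g : A →ₐ[k] C) (a : A) :
    inl f g (f a) = inr f g (g a) := DFunLike.congr_fun (glue f g) a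

/-- The homomorphism `b ⊗ c ↦ p b * q c`. -/
def lift {f : A →ₐ[k] B} {g : A →ₐ[k] C} (p : B →ₐ[k] R) (q : C →ₐ[k] R)
    (h : p.comp f = q.comp g) : Amalg f g →ₐ[k] R :=
  letI : Algebra A R := (p.comp f).toRingHom.toAlgebra
  letI : IsScalarTower k A R := IsScalarTower.of_algebraMap_eq (fun r => ((p.comp f).commutes r).symm)
  (Algebra.TensorProduct.productMap (R := A) (A := Via f) (B := Via g) (S := R)
    { p.toRingHom with commutes' := fun _ => rfl }
    { q.toRingHom with commutes' := fun a => (DFunLike.congr_fun h a).symm }).restrictScalars k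

@[simp] theorem lift_inl {f : A →ₐ[k] B} {g : A →ₐ[k] C} (p : B →ₐ[k] R) (q : C →ₐ[k] R)
    (h : p.comp f = q.comp g) (b : B) : lift p q h (inl f g b) = p b := by
  let _ : Algebra A R := (p.comp f).toRingHom.toAlgebra
  refine (Algebra.TensorProduct.productMap_apply_tmul (R := A) (A := Via f) (B := Via g) (S := R)
    _ _ _ _).trans ?_
  rw [map_one, mul_one]; rfl

@[simp] theorem lift_inr {f : A →ₐ[k] B} {g : A →ₐ[k] C} (p : B →ₐ[k] R) (q : C →ₐ[k] R)
    (h : p.comp f = q.comp g) (c : C) : lift p q h (inr f g c) = q c := by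
  let _ : Algebra A R := (p.comp f).toRingHom.toAlgebra
  refine (Algebra.TensorProduct.productMap_apply_tmul (R := A) (A := Via f) (B := Via g) (S := R)
    _ _ _ _).trans ?_
  rw [map_one, one_mul]; rfl

theorem hom_ext {f : A →ₐ[k] B} {g : A →ₐ[k] C} {p q : Amalg f g →ₐ[k] R}
    (h₁ : ∀ b, p (inl f g b) = q (inl f g b)) (h₂ : ∀ c, p (inr f g c) = q (inr f g c)) :
    p = q := by
  apply AlgHom.ext
  intro x
  induction x using Amalg.induction with
  | h0 => simp
  | hadd x y hx hy => rw [map_add, map_add, hx, hy]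
  | h b c => rw [map_mul, map_mul, h₁, h₂]

theorem map_lift {Q : Type*} [CommRing Q] [Algebra k Q] {f : A →ₐ[k] B} {g : A →ₐ[k] C}
    (r : R →ₐ[k] Q) (p : B →ₐ[k] R) (q : C →ₐ[k] R) (h : p.comp f = q.comp g) (z : Amalg f g) :
    r (lift p q h z) = lift (r.comp p) (r.comp q)
      (by rw [AlgHom.comp_assoc, h, AlgHom.comp_assoc]) z := by
  refine DFunLike.congr_fun (f := r.comp (lift p q h)) (hom_ext ?_ ?_) z <;> intro x <;> simp

theorem lift_congr {f : A →ₐ[k] B} {g : A →ₐ[k] C} {p p' : B →ₐ[k] R} {q q' : C →ₐ[k] R}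
    (h : p.comp f = q.comp g) (h' : p'.comp f = q'.comp g) (hp : p = p') (hq : q = q')
    (z : Amalg f g) : lift p q h z = lift p' q' h' z := by
  subst hp hq; rfl

end Amalg

end Amalgam

open Amalg in
/-- A commutative Hopf algebroid `(A, H)` over `k`: source `s`, target `t`, counit `ε`,
comultiplication `Δ : H → H ⊗[A] H` (`A` acts on the left factor through `t` and on the right
factor through `s`), and antipode `S`. -/
structure HopfAlgebroid (k A H : Type*) [CommRing k] [CommRing A] [CommRing H] [Algebra k A]
    [Algebra k H] where
  s : A →ₐ[k] H
  t : A →ₐ[k] H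
  ε : H →ₐ[k] A
  Δ : H →ₐ[k] Amalg t s
  S : H →ₐ[k] H
  ε_s : ε.comp s = AlgHom.id k A
  ε_t : ε.comp t = AlgHom.id k A
  Δ_s : Δ.comp s = (inl t s).comp s
  Δ_t : Δ.comp t = (inr t s).comp t
  S_s : S.comp s = t
  S_t : S.comp t = s
  /-- `(ε ⊗ id) ∘ Δ = id` -/
  counit_left : (lift (s.comp ε) (AlgHom.id k H)
    (by rw [AlgHom.comp_assoc, ε_t]; rfl)).comp Δ = AlgHom.id k H
  /-- `(id ⊗ ε) ∘ Δ = id` -/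
  counit_right : (lift (AlgHom.id k H) (t.comp ε)
    (by rw [AlgHom.comp_assoc, ε_s]; rfl)).comp Δ = AlgHom.id k H
  /-- `(Δ ⊗ id) ∘ Δ = (id ⊗ Δ) ∘ Δ` as maps to `(H ⊗[A] H) ⊗[A] H` -/
  coassoc :
    (lift ((inl ((inr t s).comp t) s).comp Δ) (inr ((inr t s).comp t) s)
      (by rw [AlgHom.comp_assoc, Δ_t, glue])).comp Δ =
    (lift ((inl ((inr t s).comp t) s).comp (inl t s))
      ((lift ((inl ((inr t s).comp t) s).comp (inr t s)) (inr ((inr t s).comp t) s)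
        (by rw [AlgHom.comp_assoc, glue])).comp Δ)
      (by
        rw [AlgHom.comp_assoc, AlgHom.comp_assoc, Δ_s, glue]
        ext a; simp)).comp Δ
  /-- `S(h₁) h₂ = t (ε h)` -/
  antipode_left : (lift S (AlgHom.id k H) (by rw [S_t]; rfl)).comp Δ = t.comp ε
  /-- `h₁ S(h₂) = s (ε h)` -/
  antipode_right : (lift (AlgHom.id k H) S (by rw [S_s]; rfl)).comp Δ = s.comp ε

namespace HopfAlgebroid

open Amalg

variable {k A H K : Type*} [CommRing k] [CommRing A] [CommRing H] [CommRing K] [Algebra k A]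
  [Algebra k H] [Algebra k K]

/-- A morphism `(A, H) → (A, K)` of Hopf algebroids over the identity of `A`. -/
structure Hom (ℋ : HopfAlgebroid k A H) (𝒦 : HopfAlgebroid k A K) where
  toAlgHom : H →ₐ[k] K
  map_s : toAlgHom.comp ℋ.s = 𝒦.s
  map_t : toAlgHom.comp ℋ.t = 𝒦.t
  map_ε : 𝒦.ε.comp toAlgHom = ℋ.ε
  map_Δ : 𝒦.Δ.comp toAlgHom =
    (lift ((inl 𝒦.t 𝒦.s).comp toAlgHom) ((inr 𝒦.t 𝒦.s).comp toAlgHom)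
      (by rw [AlgHom.comp_assoc, AlgHom.comp_assoc, map_t, map_s, glue])).comp ℋ.Δ
  map_S : 𝒦.S.comp toAlgHom = toAlgHom.comp ℋ.S

/-- The objects of the groupoid of `R`-points of `(A, H)`: the `k`-algebra maps `A → R`. -/
@[ext] structure Pt (ℋ : HopfAlgebroid k A H) (R : Type*) [CommRing R] [Algebra k R] where
  pt : A →ₐ[k] R

variable {R : Type*} [CommRing R] [Algebra k R]

/-- The arrows of the groupoid of `R`-points: the `k`-algebra maps `g : H → R`; the source of `g`
is `g ∘ t` and its target is `g ∘ s`. -/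
@[ext] structure Arr {ℋ : HopfAlgebroid k A H} (x y : Pt ℋ R) where
  hom : H →ₐ[k] R
  src : hom.comp ℋ.t = x.pt
  tgt : hom.comp ℋ.s = y.pt

namespace Arr

variable {ℋ : HopfAlgebroid k A H}

/-- The identity arrow `x ∘ ε`. -/
def id (x : Pt ℋ R) : Arr x x where
  hom := x.pt.comp ℋ.ε
  src := by rw [AlgHom.comp_assoc, ℋ.ε_t]; rfl
  tgt := by rw [AlgHom.comp_assoc, ℋ.ε_s]; rfl

theorem composable {x y z : Pt ℋ R} (f : Arr x y) (g : Arr y z) :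
    g.hom.comp ℋ.t = f.hom.comp ℋ.s := g.src.trans f.tgt.symm

/-- The composite `h ↦ g(h₁) f(h₂)` of `f : x → y` and `g : y → z`. -/
def comp {x y z : Pt ℋ R} (f : Arr x y) (g : Arr y z) : Arr x z where
  hom := (lift g.hom f.hom (composable f g)).comp ℋ.Δ
  src := by
    rw [AlgHom.comp_assoc, ℋ.Δ_t, ← f.src]; ext a; simp
  tgt := by
    rw [AlgHom.comp_assoc, ℋ.Δ_s, ← g.tgt]; ext a; simp

/-- The inverse arrow `f ∘ S`. -/
def inv {x y : Pt ℋ R} (f : Arr x y) : Arr y x where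
  hom := f.hom.comp ℋ.S
  src := by rw [AlgHom.comp_assoc, ℋ.S_t, f.tgt]
  tgt := by rw [AlgHom.comp_assoc, ℋ.S_s, f.src]

theorem id_comp {x y : Pt ℋ R} (f : Arr x y) : (id x).comp f = f := by
  apply Arr.ext
  apply AlgHom.ext
  intro a
  have h := congrArg f.hom (DFunLike.congr_fun ℋ.counit_right a)
  rw [AlgHom.comp_apply, map_lift] at h
  refine Eq.trans (lift_congr (composable (id x) f) _ rfl ?_ _) h
  rw [← AlgHom.comp_assoc, f.src]; rfl

theorem comp_id {x y : Pt ℋ R} (f : Arr x y) : f.comp (id y) = f := by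
  apply Arr.ext
  apply AlgHom.ext
  intro a
  have h := congrArg f.hom (DFunLike.congr_fun ℋ.counit_left a)
  rw [AlgHom.comp_apply, map_lift] at h
  refine Eq.trans (lift_congr (composable f (id y)) _ ?_ rfl _) h
  rw [← AlgHom.comp_assoc, f.tgt]; rfl

theorem inv_comp {x y : Pt ℋ R} (f : Arr x y) : f.inv.comp f = id y := by
  apply Arr.ext
  apply AlgHom.ext
  intro a
  have h := congrArg f.hom (DFunLike.congr_fun ℋ.antipode_right a)
  rw [AlgHom.comp_apply, map_lift] at h
  refine Eq.trans (lift_congr (composable f.inv f) _ rfl rfl _) (h.trans ?_)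
  exact DFunLike.congr_fun f.tgt (ℋ.ε a)

theorem comp_inv {x y : Pt ℋ R} (f : Arr x y) : f.comp f.inv = id x := by
  apply Arr.ext
  apply AlgHom.ext
  intro a
  have h := congrArg f.hom (DFunLike.congr_fun ℋ.antipode_left a)
  rw [AlgHom.comp_apply, map_lift] at h
  refine Eq.trans (lift_congr (composable f f.inv) _ rfl rfl _) (h.trans ?_)
  exact DFunLike.congr_fun f.src (ℋ.ε a)

theorem assoc {w x y z : Pt ℋ R} (f : Arr w x) (g : Arr x y) (h : Arr y z) :
    (f.comp g).comp h = f.comp (g.comp h) := by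
  apply Arr.ext
  apply AlgHom.ext
  intro a
  have c₁ : h.hom.comp ℋ.t = g.hom.comp ℋ.s := h.src.trans g.tgt.symm
  have c₂ : (lift h.hom g.hom c₁).comp ((inr ℋ.t ℋ.s).comp ℋ.t) = f.hom.comp ℋ.s := by
    rw [f.tgt, ← g.src]; ext a; simp
  have key := congrArg (lift (lift h.hom g.hom c₁) f.hom c₂) (DFunLike.congr_fun ℋ.coassoc a)
  rw [AlgHom.comp_apply, AlgHom.comp_apply, map_lift, map_lift] at key
  refine Eq.trans (lift_congr (composable (f.comp g) h) _ ?_ ?_ _)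
    (key.symm.trans (lift_congr _ (composable f (g.comp h)) ?_ ?_ _))
  · ext b; simp
  · ext b
    rw [AlgHom.comp_apply, AlgHom.comp_apply, map_lift]
    exact lift_congr (composable f g) _ (by ext c; simp) (by ext c; simp) _
  · ext b
    simp only [AlgHom.comp_apply, lift_inl]; rfl
  · ext b; simp

end Arr

/-- The groupoid of `R`-points of the Hopf algebroid `(A, H)`; for `R = k` this is its character
groupoid. -/
instance (ℋ : HopfAlgebroid k A H) : CategoryTheory.Groupoid (Pt ℋ R) where
  Hom x y := Arr x y
  id := Arr.id
  comp f g := f.comp g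
  inv f := f.inv
  id_comp := Arr.id_comp
  comp_id := Arr.comp_id
  assoc := Arr.assoc
  inv_comp := Arr.inv_comp
  comp_inv := Arr.comp_inv

end HopfAlgebroid

/-- A differential module over `(ℂ[X], d/dX)`: a finitely generated module with an additive map `∂`
satisfying the Leibniz rule. (Applied to constants `a ∈ ℂ`, the Leibniz rule says that `∂` is
`ℂ`-linear.) -/
structure DiffMod where
  carrier : Type
  [grp : AddCommGroup carrier]
  [mod : Module ℂ[X] carrier]
  [fin : Module.Finite ℂ[X] carrier]
  d : carrier →+ carrier
  leibniz : ∀ (a : ℂ[X]) (x : carrier), d (a • x) = Polynomial.derivative a • x + a • d x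

namespace DiffMod

instance : CoeSort DiffMod Type := ⟨DiffMod.carrier⟩

attribute [instance] DiffMod.grp DiffMod.mod DiffMod.fin

instance (P : DiffMod) : Module ℂ P := Module.compHom P (Polynomial.C : ℂ →+* ℂ[X])

instance (P : DiffMod) : IsScalarTower ℂ ℂ[X] P where
  smul_assoc c a x := by
    rw [Polynomial.smul_eq_C_mul, mul_smul]; rfl

theorem d_smul (P : DiffMod) (c : ℂ) (x : P) : P.d (c • x) = c • P.d x := by
  have := P.leibniz (Polynomial.C c) x
  rwa [Polynomial.derivative_C, zero_smul, zero_add] at this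

/-- The `A`-linear dual of the underlying module. -/
abbrev Dual (P : DiffMod) : Type := Module.Dual ℂ[X] P

/-- Morphisms of differential modules: linear maps commuting with the differentials. -/
structure Hom (P Q : DiffMod) where
  toLin : P →ₗ[ℂ[X]] Q
  map_d : ∀ x, toLin (P.d x) = Q.d (toLin x)

theorem smul_eq_zero_of_torsion (P : DiffMod) (n : ℕ) : ∀ b : ℂ[X], b.natDegree = n → b ≠ 0 →
    (∀ x : P, (∃ a : ℂ[X], a ≠ 0 ∧ a • x = 0) → b • x = 0) →
    ∀ x : P, (∃ a : ℂ[X], a ≠ 0 ∧ a • x = 0) → x = 0 := by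
  induction n with
  | zero =>
    intro b hn hb h x hx
    have hc := Polynomial.eq_C_of_natDegree_eq_zero hn
    have h0 : b.coeff 0 ≠ 0 := fun h0 => hb (by rw [hc, h0, Polynomial.C_0])
    have := congrArg (Polynomial.C (b.coeff 0)⁻¹ • ·) (h x hx)
    simp only [smul_zero, smul_smul] at this
    rw [hc, Polynomial.coeff_C_zero, ← Polynomial.C_mul, inv_mul_cancel₀ h0, Polynomial.C_1, one_smul] at this
    exact this
  | succ n ih =>
    intro b hn hb h x hx
    refine ih (Polynomial.derivative b) ?_ ?_ ?_ x hx
    · rw [Polynomial.natDegree_derivative, hn]; rfl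
    · intro h0
      have := Polynomial.derivative_eq_zero.1 h0
      omega
    · rintro y ⟨a, ha, hay⟩
      have h1 := P.leibniz b y
      rw [h y ⟨a, ha, hay⟩, map_zero, h (P.d y) ⟨a * a, mul_ne_zero ha ha, ?_⟩, add_zero] at h1
      · exact h1.symm
      · have h2 := congrArg (a • ·) (P.leibniz a y)
        simp only [hay, map_zero, smul_zero, smul_add] at h2
        rw [smul_comm a, hay, smul_zero, zero_add, smul_smul] at h2
        exact h2.symm

/-- A differential module is torsion free. -/
theorem torsionFree (P : DiffMod) : Module.IsTorsionFree ℂ[X] P := by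
  have htor : Module.IsTorsion ℂ[X] (Submodule.torsion ℂ[X] P) := Submodule.torsion_isTorsion
  obtain ⟨b, hb, hb0⟩ := Submodule.annihilator_top_inter_nonZeroDivisors htor
  rw [Submodule.isTorsionFree_iff_torsion_eq_bot, eq_bot_iff]
  intro x hx
  rw [SetLike.mem_coe, Submodule.mem_annihilator] at hb
  obtain ⟨c, hc⟩ := (Submodule.mem_torsion_iff x).1 hx
  refine P.smul_eq_zero_of_torsion _ b rfl (nonZeroDivisors.ne_zero hb0) ?_ x
    ⟨c, nonZeroDivisors.ne_zero c.2, hc⟩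
  rintro y ⟨a, ha, hay⟩
  exact congrArg Subtype.val (hb ⟨y, (Submodule.mem_torsion_iff y).2
    ⟨⟨a, mem_nonZeroDivisors_of_ne_zero ha⟩, hay⟩⟩ trivial)

/-- A differential module is free. -/
instance (P : DiffMod) : Module.Free ℂ[X] P :=
  haveI := P.torsionFree
  inferInstance

/-- The unit object `(ℂ[X], d/dX)`. -/
def unit : DiffMod where
  carrier := ℂ[X]
  d := (Polynomial.derivative : ℂ[X] →ₗ[ℂ] ℂ[X]).toAddMonoidHom
  leibniz a x := by
    simp [Polynomial.derivative_mul]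

/-- The map `x ⊗ y ↦ ∂ x ⊗ y + x ⊗ ∂ y`. -/
def tensorD (P Q : DiffMod) : P ⊗[ℂ[X]] Q →+ P ⊗[ℂ[X]] Q :=
  TensorProduct.liftAddHom
    { toFun := fun x =>
        { toFun := fun y => P.d x ⊗ₜ y + x ⊗ₜ Q.d y
          map_zero' := by simp
          map_add' := fun y y' => by simp [TensorProduct.tmul_add]; abel }
      map_zero' := by ext; simp
      map_add' := fun x x' => by ext; simp [TensorProduct.add_tmul]; abel }
    (fun a x y => by
      simp [P.leibniz, Q.leibniz, TensorProduct.add_tmul, TensorProduct.tmul_add,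
        TensorProduct.smul_tmul]
      abel)

@[simp] theorem tensorD_tmul (P Q : DiffMod) (x : P) (y : Q) :
    tensorD P Q (x ⊗ₜ y) = P.d x ⊗ₜ y + x ⊗ₜ Q.d y := rfl

/-- The tensor product `P ⊗[A] Q` with `∂ (x ⊗ y) = ∂ x ⊗ y + x ⊗ ∂ y`. -/
def tensor (P Q : DiffMod) : DiffMod where
  carrier := P ⊗[ℂ[X]] Q
  d := tensorD P Q
  leibniz a z := by
    induction z using TensorProduct.induction_on with
    | zero => simp
    | add x y hx hy => rw [smul_add, map_add, hx, hy, map_add, smul_add, smul_add]; abel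
    | tmul x y =>
      rw [TensorProduct.smul_tmul', tensorD_tmul, tensorD_tmul, P.leibniz, TensorProduct.add_tmul]
      simp only [smul_add, TensorProduct.smul_tmul', add_assoc]

/-- The dual `P^*` with `(∂ φ) x = ∂ (φ x) - φ (∂ x)`. -/
def dual (P : DiffMod) : DiffMod where
  carrier := Dual P
  d :=
    { toFun := fun φ =>
        { toFun := fun x => Polynomial.derivative (φ x) - φ (P.d x)
          map_add' := fun x y => by simp; ring
          map_smul' := fun a x => by
            simp [P.leibniz, Polynomial.derivative_mul]; ring }
      map_zero' := by ext; simp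
      map_add' := fun φ ψ => by ext1 x; simp; ring }
  leibniz a φ := by
    ext1 x
    simp [Polynomial.derivative_mul]; ring

/-- The direct sum. -/
def prod (P Q : DiffMod) : DiffMod where
  carrier := P × Q
  d := P.d.prodMap Q.d
  leibniz a x := by
    ext <;> simp [P.leibniz, Q.leibniz]

end DiffMod

namespace DiffMod

/-- The pure tensor `x ⊗ y`, as an element of the differential module `P ⊗ Q`. -/
def tmul {P Q : DiffMod} (x : P) (y : Q) : tensor P Q := TensorProduct.tmul ℂ[X] x y

/-- The linear form `x ⊗ y ↦ φ x * ψ y` on `P ⊗ Q`. -/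
def fstar {P Q : DiffMod} (φ : Dual P) (ψ : Dual Q) : Dual (tensor P Q) :=
  (TensorProduct.lift ((LinearMap.mul ℂ[X] ℂ[X]).compl₁₂ φ ψ) : P ⊗[ℂ[X]] Q →ₗ[ℂ[X]] ℂ[X])

section

variable {P Q R : DiffMod}

theorem fstar_tmul (φ : Dual P) (ψ : Dual Q) (x : P) (y : Q) :
    fstar φ ψ (tmul x y) = φ x * ψ y := rfl

theorem tmul_add (x : P) (y z : Q) : tmul x (y + z) = tmul x y + tmul x z :=
  TensorProduct.tmul_add x y z

theorem add_tmul (x y : P) (z : Q) : tmul (x + y) z = tmul x z + tmul y z :=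
  TensorProduct.add_tmul x y z

theorem zero_tmul (z : Q) : tmul (0 : P) z = 0 := TensorProduct.zero_tmul _ z

theorem smul_tmul' (a : ℂ[X]) (x : P) (y : Q) : tmul (a • x) y = a • tmul x y := rfl

theorem tmul_smul (a : ℂ[X]) (x : P) (y : Q) : tmul x (a • y) = a • tmul x y :=
  TensorProduct.tmul_smul a x y

theorem d_tmul (x : P) (y : Q) : (tensor P Q).d (tmul x y) = tmul (P.d x) y + tmul x (Q.d y) := rfl

theorem tensor_induction {p : tensor P Q → Prop} (z : tensor P Q) (h0 : p 0)
    (hadd : ∀ x y, p x → p y → p (x + y)) (h : ∀ x y, p (tmul x y)) : p z :=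
  TensorProduct.induction_on (motive := p) z h0 h hadd

theorem tensor_ext {N : Type*} [AddCommGroup N] [Module ℂ[X] N] {f g : tensor P Q →ₗ[ℂ[X]] N}
    (h : ∀ x y, f (tmul x y) = g (tmul x y)) : f = g := by
  refine LinearMap.ext fun z => ?_
  induction z using tensor_induction with
  | h0 => simp
  | hadd x y hx hy => rw [map_add, map_add, hx, hy]
  | h x y => exact h x y

/-- A bilinear map induces a linear map on the tensor product. -/
def tlift {N : Type*} [AddCommGroup N] [Module ℂ[X] N] (f : P →ₗ[ℂ[X]] Q →ₗ[ℂ[X]] N) :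
    tensor P Q →ₗ[ℂ[X]] N :=
  (TensorProduct.lift f : P ⊗[ℂ[X]] Q →ₗ[ℂ[X]] N)

theorem tlift_tmul {N : Type*} [AddCommGroup N] [Module ℂ[X] N] (f : P →ₗ[ℂ[X]] Q →ₗ[ℂ[X]] N)
    (x : P) (y : Q) : tlift f (tmul x y) = f x y := rfl

/-- A map on a tensor product commutes with differentials if it does so on pure tensors. -/
def tensorHom (f : tensor P Q →ₗ[ℂ[X]] R)
    (h : ∀ x y, f (tmul (P.d x) y) + f (tmul x (Q.d y)) = R.d (f (tmul x y))) :
    Hom (tensor P Q) R where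
  toLin := f
  map_d z := by
    induction z using tensor_induction with
    | h0 => simp
    | hadd x y hx hy => simp only [map_add, hx, hy]
    | h x y => rw [d_tmul, map_add, h]

end

/-- `x ⊗ y ↦ y ⊗ x`. -/
def swap (P Q : DiffMod) : Hom (tensor P Q) (tensor Q P) :=
  tensorHom (TensorProduct.comm ℂ[X] P Q).toLinearMap fun x y => by
    change tmul y (P.d x) + tmul (Q.d y) x = (tensor Q P).d (tmul y x)
    rw [d_tmul, add_comm]

/-- The linear map `(x ⊗ y) ⊗ z ↦ x ⊗ (y ⊗ z)`. -/
def assocLin (P Q R : DiffMod) : tensor (tensor P Q) R →ₗ[ℂ[X]] tensor P (tensor Q R) :=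
  (TensorProduct.assoc ℂ[X] P Q R).toLinearMap

theorem assocLin_tmul {P Q R : DiffMod} (x : P) (y : Q) (z : R) :
    assocLin P Q R (tmul (tmul x y) z) = tmul x (tmul y z) := rfl

/-- `(x ⊗ y) ⊗ z ↦ x ⊗ (y ⊗ z)`. -/
def assocHom (P Q R : DiffMod) : Hom (tensor (tensor P Q) R) (tensor P (tensor Q R)) :=
  tensorHom (assocLin P Q R) fun w z => by
    induction w using tensor_induction with
    | h0 => simp only [map_zero, zero_tmul, add_zero]
    | hadd v w hv hw =>
      simp only [add_tmul, map_add] at *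
      rw [← hv, ← hw]; abel
    | h x y =>
      rw [d_tmul, add_tmul, map_add, assocLin_tmul, assocLin_tmul, assocLin_tmul, assocLin_tmul,
        d_tmul, d_tmul, tmul_add]; abel

/-- The identity of `ℂ[X]`, as a linear form on the unit object. -/
def toPoly : Dual unit := (LinearMap.id : ℂ[X] →ₗ[ℂ[X]] ℂ[X])

/-- A polynomial, as an element of the unit object. -/
def ofPoly : ℂ[X] →ₗ[ℂ[X]] unit := (LinearMap.id : ℂ[X] →ₗ[ℂ[X]] ℂ[X])

@[simp] theorem toPoly_ofPoly (a : ℂ[X]) : toPoly (ofPoly a) = a := rfl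

theorem toPoly_d (a : unit) : toPoly (unit.d a) = Polynomial.derivative (toPoly a) := rfl

theorem d_ofPoly (a : ℂ[X]) : unit.d (ofPoly a) = ofPoly (Polynomial.derivative a) := rfl

theorem toPoly_injective : Function.Injective toPoly := fun _ _ h => h

/-- `x ⊗ a ↦ a • x`. -/
def runit (P : DiffMod) : Hom (tensor P unit) P :=
  tensorHom (tlift ((LinearMap.lsmul ℂ[X] P ∘ₗ toPoly).flip)) fun x a => by
    simp only [tlift_tmul, LinearMap.flip_apply, LinearMap.comp_apply, LinearMap.lsmul_apply,
      toPoly_d, P.leibniz]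
    rw [add_comm]

theorem runit_tmul {P : DiffMod} (x : P) (a : unit) :
    (runit P).toLin (tmul x a) = toPoly a • x := rfl

end DiffMod

open DiffMod

instance : DecidableEq DiffMod := Classical.decEq _

/-- The vector space `P^* ⊗ P`. -/
def CoEnd (P : DiffMod) : Type := Dual P ⊗[ℂ] P

instance (P : DiffMod) : AddCommGroup (CoEnd P) := inferInstanceAs (AddCommGroup (Dual P ⊗[ℂ] P))
instance (P : DiffMod) : Module ℂ (CoEnd P) := inferInstanceAs (Module ℂ (Dual P ⊗[ℂ] P))

/-- The element `φ ⊗ p` of `P^* ⊗ P`. -/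
def CoEnd.mk {P : DiffMod} : Dual P →ₗ[ℂ] P →ₗ[ℂ] CoEnd P := TensorProduct.mk ℂ (Dual P) P

theorem CoEnd.induction {P : DiffMod} {p : CoEnd P → Prop} (z : CoEnd P) (h0 : p 0)
    (hadd : ∀ x y, p x → p y → p (x + y)) (h : ∀ φ x, p (CoEnd.mk φ x)) : p z :=
  TensorProduct.induction_on (motive := p) z h0 h hadd

/-- The linear map on `P^* ⊗ P` given by a bilinear map. -/
def CoEnd.lift {P : DiffMod} {V : Type*} [AddCommGroup V] [Module ℂ V]
    (f : Dual P →ₗ[ℂ] P →ₗ[ℂ] V) : CoEnd P →ₗ[ℂ] V :=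
  (TensorProduct.lift f : Dual P ⊗[ℂ] P →ₗ[ℂ] V)

theorem CoEnd.lift_mk {P : DiffMod} {V : Type*} [AddCommGroup V] [Module ℂ V]
    (f : Dual P →ₗ[ℂ] P →ₗ[ℂ] V) (φ : Dual P) (p : P) : CoEnd.lift f (CoEnd.mk φ p) = f φ p := rfl

/-- The direct sum of all `P^* ⊗ P`. -/
abbrev PreDual : Type 1 := DirectSum DiffMod CoEnd

/-- The inclusion of the summand `P^* ⊗ P`. -/
abbrev incl (P : DiffMod) : CoEnd P →ₗ[ℂ] PreDual := DirectSum.lof ℂ DiffMod CoEnd P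

/-- The relations `ψ ⊗ t p = (ψ ∘ t) ⊗ p` for all morphisms `t : P → Q` of differential modules.
For `P = Q` they express that the tensor products are taken over the endomorphism rings
`T_P`. -/
def relations : Submodule ℂ PreDual :=
  Submodule.span ℂ {z | ∃ (P Q : DiffMod) (t : Hom P Q) (ψ : Dual Q) (p : P),
    z = incl Q (CoEnd.mk ψ (t.toLin p)) - incl P (CoEnd.mk (ψ ∘ₗ t.toLin) p)}

/-- The finite dual `U°` of the first Weyl algebra `U`: the quotient of `⨁ P^* ⊗_{T_P} P` (sum over
all differential modules `P`) by the relations `ψ ⊗ t p = ψ t ⊗ p`. -/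
def FinDual : Type 1 := PreDual ⧸ relations

namespace FinDual

instance : AddCommGroup FinDual := inferInstanceAs (AddCommGroup (PreDual ⧸ relations))
instance : Module ℂ FinDual := inferInstanceAs (Module ℂ (PreDual ⧸ relations))

/-- The class of `φ ⊗ p` in `U°`. -/
def cls {P : DiffMod} (φ : Dual P) (p : P) : FinDual :=
  Submodule.Quotient.mk (p := relations) (incl P (CoEnd.mk φ p))

section

variable {P Q : DiffMod}

theorem cls_add (φ : Dual P) (p q : P) : cls φ (p + q) = cls φ p + cls φ q := by
  unfold cls; rw [map_add, map_add]; rfl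

theorem add_cls (φ ψ : Dual P) (p : P) : cls (φ + ψ) p = cls φ p + cls ψ p := by
  unfold cls; rw [map_add, LinearMap.add_apply, map_add]; rfl

theorem cls_smul (c : ℂ) (φ : Dual P) (p : P) : cls φ (c • p) = c • cls φ p := by
  unfold cls; rw [map_smul, map_smul]; rfl

theorem smul_cls (c : ℂ) (φ : Dual P) (p : P) : cls (c • φ) p = c • cls φ p := by
  unfold cls; rw [map_smul, LinearMap.smul_apply, map_smul]; rfl

theorem cls_map (t : Hom P Q) (ψ : Dual Q) (p : P) : cls ψ (t.toLin p) = cls (ψ ∘ₗ t.toLin) p :=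
  (Submodule.Quotient.eq relations).2 (Submodule.subset_span ⟨P, Q, t, ψ, p, rfl⟩)

theorem cls_map' (t : Hom P Q) (ψ : Dual Q) (φ : Dual P) (p : P) (q : Q)
    (hq : t.toLin p = q) (hφ : ∀ x, ψ (t.toLin x) = φ x) : cls ψ q = cls φ p := by
  have h : ψ ∘ₗ t.toLin = φ := LinearMap.ext hφ
  rw [← hq, cls_map, h]

theorem cls_zero (φ : Dual P) : cls φ (0 : P) = 0 := by
  have := cls_smul 0 φ (0 : P)
  rwa [zero_smul, zero_smul] at this

theorem zero_cls (p : P) : cls (0 : Dual P) p = 0 := by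
  have := smul_cls 0 (0 : Dual P) p
  rwa [zero_smul, zero_smul] at this

theorem cls_sum {ι : Type*} (s : Finset ι) (φ : Dual P) (f : ι → P) :
    cls φ (∑ i ∈ s, f i) = ∑ i ∈ s, cls φ (f i) :=
  map_sum (⟨⟨cls φ, cls_zero φ⟩, cls_add φ⟩ : P →+ FinDual) f s

theorem sum_cls {ι : Type*} (s : Finset ι) (f : ι → Dual P) (p : P) :
    cls (∑ i ∈ s, f i) p = ∑ i ∈ s, cls (f i) p :=
  map_sum (⟨⟨fun φ => cls φ p, zero_cls p⟩, fun φ ψ => add_cls φ ψ p⟩ : Dual P →+ FinDual) f s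

end

theorem induction {p : FinDual → Prop} (x : FinDual) (h0 : p 0)
    (hadd : ∀ x y, p x → p y → p (x + y)) (h : ∀ (P : DiffMod) (φ : Dual P) (q : P), p (cls φ q)) :
    p x := by
  obtain ⟨z, rfl⟩ := Submodule.Quotient.mk_surjective relations x
  induction z using DirectSum.induction_on with
  | zero => exact h0
  | add x y hx hy => exact hadd _ _ hx hy
  | of P w =>
    induction w using CoEnd.induction with
    | h0 => rw [map_zero]; exact h0
    | hadd x y hx hy => rw [map_add]; exact hadd _ _ hx hy
    | h φ q => exact h P φ q

/-- The linear map `[φ ⊗ p] ↦ f φ p` on `U°`, for a dinatural family of bilinear maps `f`. -/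
def lift {V : Type*} [AddCommGroup V] [Module ℂ V] (f : ∀ P : DiffMod, Dual P → P → V)
    (h₁ : ∀ (P : DiffMod) (φ ψ : Dual P) (p : P), f P (φ + ψ) p = f P φ p + f P ψ p)
    (h₂ : ∀ (P : DiffMod) (c : ℂ) (φ : Dual P) (p : P), f P (c • φ) p = c • f P φ p)
    (h₃ : ∀ (P : DiffMod) (φ : Dual P) (p q : P), f P φ (p + q) = f P φ p + f P φ q)
    (h₄ : ∀ (P : DiffMod) (c : ℂ) (φ : Dual P) (p : P), f P φ (c • p) = c • f P φ p)
    (hf : ∀ (P Q : DiffMod) (t : Hom P Q) (ψ : Dual Q) (p : P),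
      f Q ψ (t.toLin p) = f P (ψ ∘ₗ t.toLin) p) : FinDual →ₗ[ℂ] V :=
  Submodule.liftQ relations
    (DirectSum.toModule ℂ DiffMod V fun P => CoEnd.lift
      (LinearMap.mk₂ ℂ (f P) (h₁ P) (h₂ P) (h₃ P) (h₄ P))) (by
      rw [relations, Submodule.span_le]
      rintro _ ⟨P, Q, t, ψ, p, rfl⟩
      rw [SetLike.mem_coe, LinearMap.mem_ker, map_sub, DirectSum.toModule_lof,
        DirectSum.toModule_lof, sub_eq_zero]
      exact hf P Q t ψ p)

@[simp] theorem lift_cls {V : Type*} [AddCommGroup V] [Module ℂ V]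
    (f : ∀ P : DiffMod, Dual P → P → V) (h₁ h₂ h₃ h₄ hf) {P : DiffMod} (φ : Dual P) (p : P) :
    lift f h₁ h₂ h₃ h₄ hf (cls φ p) = f P φ p :=
  (Submodule.liftQ_apply relations _ _).trans (DirectSum.toModule_lof ℂ P _)

end FinDual

namespace DiffMod

section

variable {P Q R : DiffMod}

theorem csmul_def (c : ℂ) (x : P) : c • x = Polynomial.C c • x := rfl

theorem csmul_dual (c : ℂ) (φ : Dual P) : c • φ = Polynomial.C c • φ :=
  LinearMap.ext fun _ => Polynomial.smul_eq_C_mul c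

theorem csmul_tmul (c : ℂ) (x : P) (y : Q) : tmul (c • x) y = c • tmul x y := rfl

theorem tmul_csmul (c : ℂ) (x : P) (y : Q) : tmul x (c • y) = c • tmul x y :=
  tmul_smul (Polynomial.C c) x y

theorem add_fstar (φ φ' : Dual P) (ψ : Dual Q) : fstar (φ + φ') ψ = fstar φ ψ + fstar φ' ψ :=
  tensor_ext fun x y => by simp [fstar_tmul, add_mul]

theorem fstar_add (φ : Dual P) (ψ ψ' : Dual Q) : fstar φ (ψ + ψ') = fstar φ ψ + fstar φ ψ' :=
  tensor_ext fun x y => by simp [fstar_tmul, mul_add]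

theorem csmul_fstar (c : ℂ) (φ : Dual P) (ψ : Dual Q) : fstar (c • φ) ψ = c • fstar φ ψ :=
  tensor_ext fun x y => by simp [fstar_tmul]

theorem fstar_csmul (c : ℂ) (φ : Dual P) (ψ : Dual Q) : fstar φ (c • ψ) = c • fstar φ ψ :=
  tensor_ext fun x y => by simp [fstar_tmul]

/-- The tensor product of two morphisms. -/
def mapHom {P' Q' : DiffMod} (f : Hom P P') (g : Hom Q Q') : Hom (tensor P Q) (tensor P' Q') :=
  tensorHom (TensorProduct.map f.toLin g.toLin : P ⊗[ℂ[X]] Q →ₗ[ℂ[X]] P' ⊗[ℂ[X]] Q') fun x y => by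
    change tmul (f.toLin (P.d x)) (g.toLin y) + tmul (f.toLin x) (g.toLin (Q.d y)) =
      (tensor P' Q').d (tmul (f.toLin x) (g.toLin y))
    rw [d_tmul, f.map_d, g.map_d]

theorem mapHom_tmul {P' Q' : DiffMod} (f : Hom P P') (g : Hom Q Q') (x : P) (y : Q) :
    (mapHom f g).toLin (tmul x y) = tmul (f.toLin x) (g.toLin y) := rfl

/-- The identity morphism. -/
def Hom.id (P : DiffMod) : Hom P P := ⟨LinearMap.id, fun _ => rfl⟩

end

end DiffMod

namespace FinDual

theorem hom_ext {V : Type*} [AddCommGroup V] [Module ℂ V] {f g : FinDual →ₗ[ℂ] V}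
    (h : ∀ (P : DiffMod) (φ : Dual P) (p : P), f (cls φ p) = g (cls φ p)) : f = g := by
  refine LinearMap.ext fun x => ?_
  induction x using FinDual.induction with
  | h0 => rw [map_zero, map_zero]
  | hadd x y hx hy => rw [map_add, map_add, hx, hy]
  | h P φ p => exact h P φ p

/-- Two linear forms on tensor products that agree on pure tensors have the same classes. -/
theorem cls_tensor {P Q R : DiffMod} (t : Hom (tensor P Q) R) (ψ : Dual R) (φ : Dual (tensor P Q))
    (p : tensor P Q) (r : R) (hr : t.toLin p = r)
    (h : ∀ x y, ψ (t.toLin (tmul x y)) = φ (tmul x y)) : cls ψ r = cls φ p :=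
  cls_map' t ψ φ p r hr (DFunLike.congr_fun (tensor_ext (f := ψ ∘ₗ t.toLin) (g := φ) h))

/-- Multiplication by the class of `φ ⊗ p`. -/
def mulCls {P : DiffMod} (φ : Dual P) (p : P) : FinDual →ₗ[ℂ] FinDual :=
  lift (fun _ ψ q => cls (fstar ψ φ) (tmul q p))
    (fun _ ψ ψ' q => by rw [add_fstar, add_cls])
    (fun _ c ψ q => by rw [csmul_fstar, smul_cls])
    (fun _ ψ q q' => by rw [add_tmul, cls_add])
    (fun _ c ψ q => by rw [csmul_tmul, cls_smul])
    (fun Q R t ψ q => cls_tensor (mapHom t (Hom.id P)) _ _ _ _ rfl fun _ _ => rfl)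

theorem mulCls_cls {P Q : DiffMod} (φ : Dual P) (p : P) (ψ : Dual Q) (q : Q) :
    mulCls φ p (cls ψ q) = cls (fstar ψ φ) (tmul q p) := lift_cls _ _ _ _ _ _ ψ q

/-- The multiplication of `U°`: `[φ ⊗ p] [ψ ⊗ q] = [(ψ ⋆ φ) ⊗ (q ⊗ p)]`. -/
def mul : FinDual →ₗ[ℂ] FinDual →ₗ[ℂ] FinDual :=
  lift (fun _ φ p => mulCls φ p)
    (fun P φ φ' p => hom_ext fun Q ψ q => by
      simp only [LinearMap.add_apply, mulCls_cls, fstar_add, add_cls])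
    (fun P c φ p => hom_ext fun Q ψ q => by
      simp only [LinearMap.smul_apply, mulCls_cls, fstar_csmul, smul_cls])
    (fun P φ p p' => hom_ext fun Q ψ q => by
      simp only [LinearMap.add_apply, mulCls_cls, tmul_add, cls_add])
    (fun P c φ p => hom_ext fun Q ψ q => by
      simp only [LinearMap.smul_apply, mulCls_cls, tmul_csmul, cls_smul])
    (fun P R t φ p => hom_ext fun Q ψ q => by
      rw [mulCls_cls, mulCls_cls]
      exact cls_tensor (mapHom (Hom.id Q) t) _ _ _ _ rfl fun _ _ => rfl)

instance : Mul FinDual := ⟨fun x y => mul x y⟩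

/-- The unit `[id_A ⊗ 1]`. -/
instance : One FinDual := ⟨cls toPoly (ofPoly 1)⟩

theorem one_def : (1 : FinDual) = cls toPoly (ofPoly 1) := rfl

theorem cls_mul_cls {P Q : DiffMod} (φ : Dual P) (p : P) (ψ : Dual Q) (q : Q) :
    cls φ p * cls ψ q = cls (fstar ψ φ) (tmul q p) := by
  change mul (cls φ p) (cls ψ q) = _
  rw [mul, lift_cls, mulCls_cls]

protected theorem add_mul (x y z : FinDual) : (x + y) * z = x * z + y * z :=
  LinearMap.map_add₂ mul x y z

protected theorem mul_add (x y z : FinDual) : x * (y + z) = x * y + x * z :=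
  map_add (mul x) y z

protected theorem zero_mul (x : FinDual) : 0 * x = 0 := LinearMap.map_zero₂ mul x

protected theorem mul_zero (x : FinDual) : x * 0 = 0 := map_zero (mul x)

protected theorem mul_comm (x y : FinDual) : x * y = y * x := by
  induction x using FinDual.induction with
  | h0 => rw [FinDual.zero_mul, FinDual.mul_zero]
  | hadd x x' hx hx' => rw [FinDual.add_mul, FinDual.mul_add, hx, hx']
  | h P φ p =>
    induction y using FinDual.induction with
    | h0 => rw [FinDual.zero_mul, FinDual.mul_zero]
    | hadd x x' hx hx' => rw [FinDual.add_mul, FinDual.mul_add, hx, hx']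
    | h Q ψ q =>
      rw [cls_mul_cls, cls_mul_cls]
      exact cls_tensor (swap P Q) _ _ _ _ rfl fun x y => mul_comm _ _

protected theorem mul_assoc (x y z : FinDual) : x * y * z = x * (y * z) := by
  induction x using FinDual.induction with
  | h0 => simp only [FinDual.zero_mul]
  | hadd x x' hx hx' => simp only [FinDual.add_mul, hx, hx']
  | h P φ p =>
    induction y using FinDual.induction with
    | h0 => simp only [FinDual.zero_mul, FinDual.mul_zero]
    | hadd x x' hx hx' => simp only [FinDual.add_mul, FinDual.mul_add, hx, hx']
    | h Q ψ q =>
      induction z using FinDual.induction with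
      | h0 => simp only [FinDual.mul_zero]
      | hadd x x' hx hx' => simp only [FinDual.mul_add, hx, hx']
      | h R χ r =>
        rw [cls_mul_cls, cls_mul_cls, cls_mul_cls, cls_mul_cls]
        refine cls_map' (assocHom R Q P) _ _ _ _ rfl (DFunLike.congr_fun
          (tensor_ext (f := fstar χ (fstar ψ φ) ∘ₗ (assocHom R Q P).toLin)
            (g := fstar (fstar χ ψ) φ) fun w z => ?_))
        induction w using tensor_induction with
        | h0 => rw [zero_tmul, map_zero, map_zero]
        | hadd v w hv hw => rw [add_tmul, map_add, map_add, hv, hw]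
        | h x y => exact (mul_assoc (χ x) (ψ y) (φ z)).symm

protected theorem one_mul (x : FinDual) : 1 * x = x := by
  induction x using FinDual.induction with
  | h0 => rw [FinDual.mul_zero]
  | hadd x x' hx hx' => rw [FinDual.mul_add, hx, hx']
  | h P φ p =>
    rw [one_def, cls_mul_cls]
    refine (cls_tensor (runit P) _ _ _ _ ?_ fun x a => ?_).symm
    · rw [runit_tmul, toPoly_ofPoly, one_smul]
    · rw [runit_tmul, fstar_tmul, map_smul, smul_eq_mul, mul_comm]

instance : CommRing FinDual where
  __ := (inferInstance : AddCommGroup FinDual)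
  left_distrib := FinDual.mul_add
  right_distrib := FinDual.add_mul
  zero_mul := FinDual.zero_mul
  mul_zero := FinDual.mul_zero
  mul_assoc := FinDual.mul_assoc
  one_mul := FinDual.one_mul
  mul_one x := (FinDual.mul_comm x 1).trans (FinDual.one_mul x)
  mul_comm := FinDual.mul_comm

instance : Algebra ℂ FinDual :=
  Algebra.ofModule (fun c x y => LinearMap.map_smul₂ mul c x y)
    (fun c x y => map_smul (mul x) c y)

theorem algebraMap_eq (c : ℂ) :
    algebraMap ℂ FinDual c = cls toPoly (ofPoly (Polynomial.C c)) := by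
  rw [Algebra.algebraMap_eq_smul_one, one_def, ← cls_smul, csmul_def, ← map_smul, smul_eq_mul,
    mul_one]

/-- The target `a ↦ [id_A ⊗ a]`. -/
def t : ℂ[X] →ₐ[ℂ] FinDual where
  toFun a := cls toPoly (ofPoly a)
  map_one' := rfl
  map_mul' a b := by
    rw [cls_mul_cls]
    refine cls_tensor (runit unit) _ _ _ _ ?_ fun x a => ?_
    · rw [runit_tmul, toPoly_ofPoly, ← map_smul, smul_eq_mul]
    · rw [runit_tmul, fstar_tmul, map_smul, smul_eq_mul, mul_comm]
  map_zero' := by rw [map_zero, cls_zero]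
  map_add' a b := by rw [map_add, cls_add]
  commutes' c := (algebraMap_eq c).symm

/-- The source `a ↦ [l_a ⊗ 1]`, where `l_a` is multiplication by `a`. -/
def s : ℂ[X] →ₐ[ℂ] FinDual where
  toFun a := cls (a • toPoly) (ofPoly 1)
  map_one' := by rw [one_smul]; rfl
  map_mul' a b := by
    rw [cls_mul_cls]
    refine cls_tensor (runit unit) _ _ _ _ ?_ fun x y => ?_
    · rw [runit_tmul, toPoly_ofPoly, one_smul]
    · rw [runit_tmul, fstar_tmul, map_smul]; simp only [LinearMap.smul_apply, smul_eq_mul]; ring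
  map_zero' := by rw [zero_smul, zero_cls]
  map_add' a b := by rw [add_smul, add_cls]
  commutes' c := by
    change cls (Polynomial.C c • toPoly) (ofPoly 1) = _
    rw [← csmul_dual, smul_cls, Algebra.algebraMap_eq_smul_one, one_def]

section

variable {P : DiffMod}

theorem s_def (a : ℂ[X]) : s a = cls (a • toPoly) (ofPoly 1) := rfl

theorem t_def (a : ℂ[X]) : t a = cls toPoly (ofPoly a) := rfl

theorem s_mul_cls (a : ℂ[X]) (φ : Dual P) (p : P) : s a * cls φ p = cls (a • φ) p := by
  rw [s_def, cls_mul_cls]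
  refine (cls_tensor (runit P) _ _ _ _ ?_ fun x b => ?_).symm
  · rw [runit_tmul, toPoly_ofPoly, one_smul]
  · rw [runit_tmul, fstar_tmul, map_smul]; simp only [LinearMap.smul_apply, smul_eq_mul]; ring

theorem t_mul_cls (a : ℂ[X]) (φ : Dual P) (p : P) : t a * cls φ p = cls φ (a • p) := by
  rw [t_def, cls_mul_cls]
  refine (cls_tensor (runit P) _ _ _ _ ?_ fun x b => ?_).symm
  · rw [runit_tmul, toPoly_ofPoly]
  · rw [runit_tmul, fstar_tmul, map_smul, smul_eq_mul, mul_comm]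

end

/-- Algebra homomorphisms out of `U°` from linear maps. -/
def algHom {R : Type*} [CommRing R] [Algebra ℂ R] (f : FinDual →ₗ[ℂ] R)
    (h1 : f 1 = 1) (hmul : ∀ (P Q : DiffMod) (φ : Dual P) (p : P) (ψ : Dual Q) (q : Q),
      f (cls φ p * cls ψ q) = f (cls φ p) * f (cls ψ q)) : FinDual →ₐ[ℂ] R :=
  AlgHom.ofLinearMap f h1 fun x y => by
    induction x using FinDual.induction with
    | h0 => simp only [zero_mul, map_zero]
    | hadd x x' hx hx' => simp only [add_mul, map_add, hx, hx']
    | h P φ p =>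
      induction y using FinDual.induction with
      | h0 => simp only [mul_zero, map_zero]
      | hadd x x' hx hx' => simp only [mul_add, map_add, hx, hx']
      | h Q ψ q => exact hmul P Q φ p ψ q

theorem algHom_ext {R : Type*} [CommRing R] [Algebra ℂ R] {f g : FinDual →ₐ[ℂ] R}
    (h : ∀ (P : DiffMod) (φ : Dual P) (p : P), f (cls φ p) = g (cls φ p)) : f = g :=
  AlgHom.toLinearMap_injective (hom_ext h)

theorem algHom_cls {R : Type*} [CommRing R] [Algebra ℂ R] (f : FinDual →ₗ[ℂ] R) (h1 hmul)
    (x : FinDual) : algHom f h1 hmul x = f x := rfl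

/-- The linear map `[φ ⊗ p] ↦ φ p`. -/
def εLin : FinDual →ₗ[ℂ] ℂ[X] :=
  lift (fun _ φ p => φ p)
    (fun _ _ _ _ => rfl) (fun _ _ _ _ => rfl) (fun _ φ => map_add φ)
    (fun _ c φ p => by
      rw [csmul_def, map_smul, smul_eq_mul, Polynomial.smul_eq_C_mul])
    (fun _ _ _ _ _ => rfl)

theorem εLin_cls {P : DiffMod} (φ : Dual P) (p : P) : εLin (cls φ p) = φ p :=
  lift_cls _ _ _ _ _ _ φ p

/-- The counit `[φ ⊗ p] ↦ φ p`. -/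
def ε : FinDual →ₐ[ℂ] ℂ[X] :=
  algHom εLin (by rw [one_def, εLin_cls, toPoly_ofPoly])
    (fun P Q φ p ψ q => by
      rw [cls_mul_cls, εLin_cls, εLin_cls, εLin_cls, fstar_tmul, mul_comm])

theorem ε_cls {P : DiffMod} (φ : Dual P) (p : P) : ε (cls φ p) = φ p := εLin_cls φ p

end FinDual

namespace DiffMod

/-- A linear form on `P`, as an element of the dual differential module. -/
def toDual {P : DiffMod} : Dual P →ₗ[ℂ[X]] dual P := (LinearMap.id : Dual P →ₗ[ℂ[X]] Dual P)

/-- Evaluation at an element of `P`, as a linear form on `P^*`. -/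
def ev {P : DiffMod} : P →ₗ[ℂ[X]] Dual (dual P) := (Module.Dual.eval ℂ[X] P)

section

variable {P Q R : DiffMod}

@[simp] theorem ev_toDual (p : P) (φ : Dual P) : ev p (toDual φ) = φ p := rfl

theorem ev_d (p : P) (φ : Dual P) :
    ev p ((dual P).d (toDual φ)) = Polynomial.derivative (φ p) - φ (P.d p) := rfl

theorem toDual_csmul (c : ℂ) (φ : Dual P) : toDual (c • φ) = c • toDual φ := by
  rw [csmul_dual, map_smul]; rfl

theorem ev_csmul (c : ℂ) (p : P) : ev (c • p) = c • ev p := by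
  rw [csmul_dual, csmul_def, map_smul]

theorem dual_ext {φ ψ : dual P} (h : ∀ p : P, ev p φ = ev p ψ) : φ = ψ :=
  LinearMap.ext (f := (φ : Dual P)) (g := (ψ : Dual P)) h

theorem dual_surj (φ : dual P) : ∃ ψ : Dual P, toDual ψ = φ := ⟨φ, rfl⟩

/-- The transpose of a morphism. -/
def transpose (u : Hom P Q) : Hom (dual Q) (dual P) where
  toLin := (u.toLin.dualMap : Dual Q →ₗ[ℂ[X]] Dual P)
  map_d ψ := dual_ext fun p => by
    obtain ⟨ψ, rfl⟩ := dual_surj ψ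
    change Polynomial.derivative (ψ (u.toLin p)) - ψ (Q.d (u.toLin p)) =
      Polynomial.derivative (ψ (u.toLin p)) - ψ (u.toLin (P.d p))
    rw [u.map_d]

theorem transpose_toDual (u : Hom P Q) (ψ : Dual Q) :
    (transpose u).toLin (toDual ψ) = toDual (ψ ∘ₗ u.toLin) := rfl

/-- The canonical map from `P` to its bidual. -/
def bidual (P : DiffMod) : Hom P (dual (dual P)) where
  toLin := toDual ∘ₗ ev
  map_d p := dual_ext fun φ => by
    obtain ⟨φ, rfl⟩ := dual_surj φ
    change φ (P.d p) = Polynomial.derivative (φ p) - (Polynomial.derivative (φ p) - φ (P.d p))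
    ring

theorem bidual_apply (p : P) : (bidual P).toLin p = toDual (ev p) := rfl

theorem smul_fstar (a : ℂ[X]) (φ : Dual P) (ψ : Dual Q) : fstar (a • φ) ψ = a • fstar φ ψ :=
  tensor_ext fun x y => by
    simp only [fstar_tmul, LinearMap.smul_apply, smul_eq_mul, mul_assoc]

theorem fstar_smul (a : ℂ[X]) (φ : Dual P) (ψ : Dual Q) : fstar φ (a • ψ) = a • fstar φ ψ :=
  tensor_ext fun x y => by
    simp only [fstar_tmul, LinearMap.smul_apply, smul_eq_mul]; ring

/-- `fstar` as a bilinear map. -/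
def fstarLin : Dual P →ₗ[ℂ[X]] Dual Q →ₗ[ℂ[X]] Dual (tensor P Q) :=
  LinearMap.mk₂ ℂ[X] fstar add_fstar smul_fstar fstar_add fstar_smul

/-- The map `P^* ⊗ Q^* → (P ⊗ Q)^*`. -/
def dualTensor (P Q : DiffMod) : Hom (tensor (dual P) (dual Q)) (dual (tensor P Q)) :=
  tensorHom (tlift (P := dual P) (Q := dual Q) (N := dual (tensor P Q)) (fstarLin (P := P) (Q := Q)))
    fun φ ψ => dual_ext fun z => by
      obtain ⟨φ, rfl⟩ := dual_surj φ
      obtain ⟨ψ, rfl⟩ := dual_surj ψ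
      induction z using tensor_induction with
      | h0 => simp only [map_zero, LinearMap.zero_apply]
      | hadd v w hv hw => simp only [map_add, LinearMap.add_apply] at *; rw [← hv, ← hw]; ring
      | h x y =>
        change (Polynomial.derivative (φ x) - φ (P.d x)) * ψ y +
          φ x * (Polynomial.derivative (ψ y) - ψ (Q.d y)) =
          Polynomial.derivative (φ x * ψ y) - fstar φ ψ ((tensor P Q).d (tmul x y))
        rw [d_tmul, map_add, fstar_tmul, fstar_tmul, Polynomial.derivative_mul]
        ring

theorem dualTensor_tmul (φ : Dual P) (ψ : Dual Q) :
    (dualTensor P Q).toLin (tmul (toDual φ) (toDual ψ)) = toDual (fstar φ ψ) := rfl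

/-- The isomorphism `A → A^*`. -/
def unitDual : Hom unit (dual unit) where
  toLin := (LinearMap.toSpanSingleton ℂ[X] (dual unit) (toDual toPoly)) ∘ₗ toPoly
  map_d a := by
    have h : (dual unit).d (toDual toPoly) = 0 := dual_ext fun p => by
      rw [ev_d, toPoly_d, sub_self, map_zero]
    simp only [LinearMap.comp_apply, LinearMap.toSpanSingleton_apply, toPoly_d]
    rw [(dual unit).leibniz, h, smul_zero, add_zero]

theorem unitDual_apply (a : unit) : unitDual.toLin a = toPoly a • toDual toPoly := rfl

/-- The pairing `P ⊗ P^* → A`. -/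
def pairing (P : DiffMod) : Hom (tensor P (dual P)) unit :=
  tensorHom (tlift (LinearMap.mk₂ ℂ[X] (fun (x : P) (φ : dual P) => ofPoly (ev x φ))
      (fun x x' φ => by rw [map_add, LinearMap.add_apply, map_add])
      (fun a x φ => by rw [map_smul, LinearMap.smul_apply, map_smul])
      (fun x φ φ' => by rw [map_add, map_add])
      (fun a x φ => by rw [map_smul, map_smul])))
    fun x φ => by
      obtain ⟨φ, rfl⟩ := dual_surj φ
      change φ (P.d x) + (Polynomial.derivative (φ x) - φ (P.d x)) = Polynomial.derivative (φ x)
      ring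

theorem pairing_tmul (x : P) (φ : dual P) : (pairing P).toLin (tmul x φ) = ofPoly (ev x φ) := rfl

variable {ι : Type*} [Fintype ι] (e : Module.Basis ι ℂ[X] P)

theorem sum_tmul {κ : Type*} (s : Finset κ) (f : κ → P) (y : Q) :
    tmul (∑ i ∈ s, f i) y = ∑ i ∈ s, tmul (f i) y := TensorProduct.sum_tmul s f y

theorem tmul_sum {κ : Type*} (s : Finset κ) (x : P) (f : κ → Q) :
    tmul x (∑ i ∈ s, f i) = ∑ i ∈ s, tmul x (f i) := TensorProduct.tmul_sum x s f

/-- The dual basis element `∑ e_i^* ⊗ e_i`. -/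
def dbElt : tensor (dual P) P := ∑ i, tmul (toDual (e.coord i)) (e i)

theorem d_dbElt : (tensor (dual P) P).d (dbElt e) = 0 := by
  have h1 : ∀ i, P.d (e i) = ∑ j, e.coord j (P.d (e i)) • e j := fun i =>
    (e.sum_repr (P.d (e i))).symm
  have h2 : ∀ i, (dual P).d (toDual (e.coord i)) =
      ∑ j, (-(e.coord i (P.d (e j)))) • toDual (e.coord j) := fun i => by
    have h3 : ∀ ψ : Dual P, ψ = ∑ j, ψ (e j) • e.coord j := fun ψ => by
      refine e.ext fun k => ?_
      classical
      simp
    obtain ⟨ψ, hψ⟩ := dual_surj ((dual P).d (toDual (e.coord i)))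
    rw [← hψ, h3 ψ, map_sum]
    refine Finset.sum_congr rfl fun j _ => ?_
    rw [map_smul, ← ev_toDual, hψ, ev_d]
    classical
    rw [Module.Basis.coord_apply, Module.Basis.repr_self, Finsupp.single_apply]
    split_ifs <;> simp
  rw [dbElt, map_sum]
  simp only [d_tmul]
  rw [Finset.sum_add_distrib]
  conv_lhs =>
    congr
    · enter [2, i]; rw [h2 i, sum_tmul]
    · enter [2, i]; rw [h1 i, tmul_sum]
  rw [Finset.sum_comm, ← Finset.sum_add_distrib]
  refine Finset.sum_eq_zero fun i _ => ?_
  rw [← Finset.sum_add_distrib]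
  refine Finset.sum_eq_zero fun j _ => ?_
  rw [smul_tmul', tmul_smul, neg_smul, neg_add_cancel]

/-- The dual basis morphism `A → P^* ⊗ P`. -/
def db : Hom unit (tensor (dual P) P) where
  toLin := (LinearMap.toSpanSingleton ℂ[X] _ (dbElt e)) ∘ₗ toPoly
  map_d a := by
    simp only [LinearMap.comp_apply, LinearMap.toSpanSingleton_apply, toPoly_d]
    rw [(tensor (dual P) P).leibniz, d_dbElt, smul_zero, add_zero]

theorem db_apply (a : unit) : (db e).toLin a = toPoly a • dbElt e := rfl

end

end DiffMod

namespace FinDual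

/-- The linear map `[φ ⊗ p] ↦ [p ⊗ φ]` (the latter a class of `P^** ⊗ P^*`). -/
def SLin : FinDual →ₗ[ℂ] FinDual :=
  lift (fun P φ p => cls (P := dual P) (ev p) (toDual φ))
    (fun P φ ψ p => by rw [map_add, cls_add])
    (fun P c φ p => by rw [toDual_csmul, cls_smul])
    (fun P φ p q => by rw [map_add, add_cls])
    (fun P c φ p => by rw [ev_csmul, smul_cls])
    (fun P Q u ψ p => (cls_map' (transpose u) (ev p) (ev (u.toLin p)) (toDual ψ) _ rfl
      fun _ => rfl).symm)

theorem SLin_cls {P : DiffMod} (φ : Dual P) (p : P) :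
    SLin (cls φ p) = cls (P := dual P) (ev p) (toDual φ) := lift_cls _ _ _ _ _ _ φ p

theorem SLin_t (a : ℂ[X]) : SLin (t a) = s a := by
  rw [t_def, SLin_cls]
  refine cls_map' unitDual _ _ _ _ ?_ fun b => ?_
  · rw [unitDual_apply, toPoly_ofPoly, one_smul]
  · rw [unitDual_apply, map_smul, ev_toDual, toPoly_ofPoly, LinearMap.smul_apply, smul_eq_mul,
      smul_eq_mul, mul_comm]

theorem SLin_s (a : ℂ[X]) : SLin (s a) = t a := by
  rw [s_def, SLin_cls]
  refine cls_map' unitDual _ _ _ _ ?_ fun b => ?_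
  · rw [unitDual_apply, toPoly_ofPoly, map_smul]
  · rw [unitDual_apply, map_smul, ev_toDual, toPoly_ofPoly, smul_eq_mul, mul_one]

/-- The antipode `[φ ⊗ p] ↦ [p ⊗ φ]` of `U°`. -/
def S : FinDual →ₐ[ℂ] FinDual :=
  algHom SLin (by rw [← map_one t, SLin_t, map_one, map_one])
    (fun P Q φ p ψ q => by
      rw [cls_mul_cls, SLin_cls, SLin_cls, SLin_cls, cls_mul_cls]
      refine cls_tensor (dualTensor Q P) _ _ _ _ (dualTensor_tmul ψ φ) fun χ ξ => ?_
      obtain ⟨χ, rfl⟩ := dual_surj χ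
      obtain ⟨ξ, rfl⟩ := dual_surj ξ
      rfl)

theorem S_cls {P : DiffMod} (φ : Dual P) (p : P) :
    S (cls φ p) = cls (P := dual P) (ev p) (toDual φ) := SLin_cls φ p

theorem S_S (x : FinDual) : S (S x) = x := by
  refine DFunLike.congr_fun (f := S.comp S) (g := AlgHom.id ℂ FinDual)
    (algHom_ext fun P φ p => ?_) x
  rw [AlgHom.comp_apply, S_cls, S_cls]
  exact cls_map' (bidual P) _ _ _ _ rfl fun _ => rfl

end FinDual

namespace FinDual

open Amalg

section

variable {P Q : DiffMod} {ι κ : Type*} [Fintype ι] [Fintype κ]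

/-- The element `∑ [φ ⊗ e_i] ⊗ [e_i^* ⊗ p]` of `U° ⊗[A] U°`, for a basis `e`. -/
def Δsum (e : Module.Basis ι ℂ[X] P) (φ : Dual P) (p : P) : Amalg t s :=
  ∑ i, inl t s (cls φ (e i)) * inr t s (cls (e.coord i) p)

theorem dual_eq_sum (e : Module.Basis ι ℂ[X] P) (φ : Dual P) : φ = ∑ i, φ (e i) • e.coord i := by
  refine e.ext fun k => ?_
  classical
  simp

theorem Δsum_map (u : Hom P Q) (e : Module.Basis ι ℂ[X] P) (f : Module.Basis κ ℂ[X] Q)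
    (ψ : Dual Q) (p : P) : Δsum f ψ (u.toLin p) = Δsum e (ψ ∘ₗ u.toLin) p := by
  have h1 : ∀ j, inr t s (cls (f.coord j) (u.toLin p)) =
      ∑ i, inl t s (t (f.coord j (u.toLin (e i)))) * inr t s (cls (e.coord i) p) := fun j => by
    rw [cls_map, dual_eq_sum e (f.coord j ∘ₗ u.toLin), sum_cls, map_sum]
    refine Finset.sum_congr rfl fun i _ => ?_
    rw [← s_mul_cls, map_mul, glue_apply, LinearMap.comp_apply]
  unfold Δsum
  simp only [h1, Finset.mul_sum]
  rw [Finset.sum_comm]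
  refine Finset.sum_congr rfl fun i _ => ?_
  simp only [← mul_assoc]
  rw [← Finset.sum_mul]
  congr 1
  rw [← cls_map, ← f.sum_repr (u.toLin (e i)), cls_sum, map_sum]
  refine Finset.sum_congr rfl fun j _ => ?_
  rw [← map_mul, mul_comm, t_mul_cls, Module.Basis.coord_apply, f.sum_repr]

theorem Δsum_eq (e : Module.Basis ι ℂ[X] P) (f : Module.Basis κ ℂ[X] P) (φ : Dual P) (p : P) :
    Δsum f φ p = Δsum e φ p := Δsum_map (Hom.id P) e f φ p

end

/-- A basis of a differential module. -/
def basis (P : DiffMod) : Module.Basis (Module.Free.ChooseBasisIndex ℂ[X] P) ℂ[X] P :=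
  Module.Free.chooseBasis ℂ[X] P

/-- The linear map `[φ ⊗ p] ↦ ∑ [φ ⊗ e_i] ⊗ [e_i^* ⊗ p]`. -/
def ΔLin : FinDual →ₗ[ℂ] Amalg t s :=
  lift (fun P φ p => Δsum (basis P) φ p)
    (fun P φ ψ p => by
      simp only [Δsum, add_cls, map_add, add_mul, Finset.sum_add_distrib])
    (fun P c φ p => by
      simp only [Δsum, smul_cls, map_smul, smul_mul_assoc, Finset.smul_sum])
    (fun P φ p q => by
      simp only [Δsum, cls_add, map_add, mul_add, Finset.sum_add_distrib])
    (fun P c φ p => by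
      simp only [Δsum, cls_smul, map_smul, mul_smul_comm, Finset.smul_sum])
    (fun P Q u ψ p => Δsum_map u _ _ ψ p)

theorem ΔLin_cls {P : DiffMod} {ι : Type*} [Fintype ι] (e : Module.Basis ι ℂ[X] P) (φ : Dual P)
    (p : P) : ΔLin (cls φ p) = Δsum e φ p :=
  (lift_cls _ _ _ _ _ _ φ p).trans (Δsum_eq _ _ φ p)

/-- The basis of the unit object. -/
def unitBasis : Module.Basis Unit ℂ[X] unit :=
  (Module.Basis.singleton Unit ℂ[X] : Module.Basis Unit ℂ[X] ℂ[X])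

theorem unitBasis_apply (i : Unit) : unitBasis i = ofPoly 1 := by
  exact Module.Basis.singleton_apply Unit ℂ[X] i

theorem unitBasis_coord (i : Unit) : unitBasis.coord i = toPoly := by
  refine unitBasis.ext fun j => ?_
  rw [Module.Basis.coord_apply, Module.Basis.repr_self, unitBasis_apply, toPoly_ofPoly]
  simp

theorem ΔLin_t (a : ℂ[X]) : ΔLin (t a) = inr t s (t a) := by
  rw [t_def, ΔLin_cls unitBasis, Δsum]
  simp only [unitBasis_apply, unitBasis_coord]
  rw [Finset.univ_unique, Finset.sum_singleton, ← one_def, map_one, one_mul]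

theorem ΔLin_s (a : ℂ[X]) : ΔLin (s a) = inl t s (s a) := by
  rw [s_def, ΔLin_cls unitBasis, Δsum]
  simp only [unitBasis_apply, unitBasis_coord]
  rw [Finset.univ_unique, Finset.sum_singleton, ← one_def, map_one (inr t s), mul_one]

/-- The tensor product of two bases. -/
def tensorBasis {P Q : DiffMod} {ι κ : Type*} (e : Module.Basis ι ℂ[X] P)
    (f : Module.Basis κ ℂ[X] Q) : Module.Basis (ι × κ) ℂ[X] (tensor P Q) :=
  (e.tensorProduct f : Module.Basis (ι × κ) ℂ[X] (P ⊗[ℂ[X]] Q))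

theorem tensorBasis_apply {P Q : DiffMod} {ι κ : Type*} (e : Module.Basis ι ℂ[X] P)
    (f : Module.Basis κ ℂ[X] Q) (x : ι × κ) : tensorBasis e f x = tmul (e x.1) (f x.2) :=
  Module.Basis.tensorProduct_apply' e f x

theorem tensorBasis_coord {P Q : DiffMod} {ι κ : Type*} (e : Module.Basis ι ℂ[X] P)
    (f : Module.Basis κ ℂ[X] Q) (x : ι × κ) :
    (tensorBasis e f).coord x = fstar (e.coord x.1) (f.coord x.2) := by
  refine (tensorBasis e f).ext fun y => ?_
  classical
  rw [Module.Basis.coord_apply, Module.Basis.repr_self, tensorBasis_apply, fstar_tmul,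
    Module.Basis.coord_apply, Module.Basis.repr_self, Module.Basis.coord_apply,
    Module.Basis.repr_self, Finsupp.single_apply, Finsupp.single_apply, Finsupp.single_apply]
  obtain ⟨x, x'⟩ := x
  obtain ⟨y, y'⟩ := y
  simp only [Prod.mk.injEq]
  split_ifs <;> simp_all

/-- The comultiplication `[φ ⊗ p] ↦ ∑ [φ ⊗ e_i] ⊗ [e_i^* ⊗ p]` of `U°`. -/
def Δ : FinDual →ₐ[ℂ] Amalg t s :=
  algHom ΔLin (by rw [← map_one t, ΔLin_t, map_one, map_one])
    (fun P Q φ p ψ q => by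
      rw [cls_mul_cls, ΔLin_cls (tensorBasis (basis Q) (basis P)), ΔLin_cls (basis P),
        ΔLin_cls (basis Q), Δsum, Δsum, Δsum, Finset.sum_mul_sum, Fintype.sum_prod_type,
        Finset.sum_comm]
      refine Finset.sum_congr rfl fun i _ => Finset.sum_congr rfl fun j _ => ?_
      rw [tensorBasis_apply, tensorBasis_coord, ← cls_mul_cls, ← cls_mul_cls, map_mul, map_mul]
      ring)

section

variable {P : DiffMod} {ι : Type*} [Fintype ι]

theorem Δ_cls (e : Module.Basis ι ℂ[X] P) (φ : Dual P) (p : P) :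
    Δ (cls φ p) = ∑ i, inl t s (cls φ (e i)) * inr t s (cls (e.coord i) p) :=
  ΔLin_cls e φ p

theorem lift_Δ {R : Type*} [CommRing R] [Algebra ℂ R] (f g : FinDual →ₐ[ℂ] R)
    (h : f.comp t = g.comp s) (e : Module.Basis ι ℂ[X] P) (φ : Dual P) (p : P) :
    Amalg.lift f g h (Δ (cls φ p)) = ∑ i, f (cls φ (e i)) * g (cls (e.coord i) p) := by
  rw [Δ_cls e, map_sum]
  simp only [map_mul, lift_inl, lift_inr]

end

theorem ε_s (a : ℂ[X]) : ε (s a) = a := by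
  rw [s_def, ε_cls, LinearMap.smul_apply, toPoly_ofPoly, smul_eq_mul, mul_one]

theorem ε_t (a : ℂ[X]) : ε (t a) = a := by
  rw [t_def, ε_cls, toPoly_ofPoly]

theorem S_s (a : ℂ[X]) : S (s a) = t a := SLin_s a

theorem S_t (a : ℂ[X]) : S (t a) = s a := SLin_t a

/-- The Hopf algebroid `(A, U°)`. -/
def hopf : HopfAlgebroid ℂ ℂ[X] FinDual where
  s := s
  t := t
  ε := ε
  Δ := Δ
  S := S
  ε_s := AlgHom.ext ε_s
  ε_t := AlgHom.ext ε_t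
  Δ_s := AlgHom.ext ΔLin_s
  Δ_t := AlgHom.ext ΔLin_t
  S_s := AlgHom.ext S_s
  S_t := AlgHom.ext S_t
  counit_left := algHom_ext fun P φ p => by
    rw [AlgHom.comp_apply, lift_Δ _ _ _ (basis P)]
    simp only [AlgHom.comp_apply, AlgHom.id_apply, ε_cls, s_mul_cls]
    rw [← sum_cls, ← dual_eq_sum]
  counit_right := algHom_ext fun P φ p => by
    rw [AlgHom.comp_apply, lift_Δ _ _ _ (basis P)]
    simp only [AlgHom.comp_apply, AlgHom.id_apply, ε_cls]
    conv_rhs => rw [← (basis P).sum_repr p, cls_sum]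
    refine Finset.sum_congr rfl fun i _ => ?_
    rw [mul_comm, t_mul_cls, Module.Basis.coord_apply]
  coassoc := algHom_ext fun P φ p => by
    rw [AlgHom.comp_apply, AlgHom.comp_apply, lift_Δ _ _ _ (basis P), lift_Δ _ _ _ (basis P)]
    simp only [AlgHom.comp_apply]
    simp only [lift_Δ _ _ _ (basis P)]
    simp only [AlgHom.comp_apply, Δ_cls (basis P), map_sum, map_mul, Finset.sum_mul,
      Finset.mul_sum]
    rw [Finset.sum_comm]
    refine Finset.sum_congr rfl fun i _ => Finset.sum_congr rfl fun j _ => ?_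
    rw [mul_assoc]
  antipode_left := algHom_ext fun P φ p => by
    rw [AlgHom.comp_apply, lift_Δ _ _ _ (basis P)]
    simp only [AlgHom.comp_apply, AlgHom.id_apply, ε_cls, S_cls, cls_mul_cls]
    rw [← sum_cls, t_def]
    refine (cls_tensor (pairing P) _ _ _ _ (pairing_tmul p (toDual φ)) fun x χ => ?_).symm
    obtain ⟨χ, rfl⟩ := dual_surj χ
    rw [pairing_tmul, toPoly_ofPoly, ev_toDual, LinearMap.sum_apply]
    simp only [fstar_tmul, ev_toDual, Module.Basis.coord_apply]
    conv_lhs => rw [← (basis P).sum_repr x, map_sum]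
    simp only [map_smul, smul_eq_mul]
  antipode_right := algHom_ext fun P φ p => by
    rw [AlgHom.comp_apply, lift_Δ _ _ _ (basis P)]
    simp only [AlgHom.comp_apply, AlgHom.id_apply, ε_cls, S_cls, cls_mul_cls]
    rw [← cls_sum, s_def]
    refine cls_map' (db (basis P)) _ _ _ _ ?_ fun a => ?_
    · rw [db_apply, toPoly_ofPoly, one_smul, dbElt]
    · rw [db_apply, map_smul, dbElt, map_sum, LinearMap.smul_apply, smul_eq_mul, smul_eq_mul,
        mul_comm]
      congr 1
      simp only [fstar_tmul, ev_toDual, Module.Basis.coord_apply]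
      conv_rhs => rw [← (basis P).sum_repr p, map_sum]
      simp only [map_smul, smul_eq_mul]

end FinDual

namespace FinDual

/-- Every element of `U°` is the class of some `φ ⊗ p`. -/
theorem exists_cls (x : FinDual) : ∃ (P : DiffMod) (φ : Dual P) (p : P), x = cls φ p := by
  induction x using FinDual.induction with
  | h0 => exact ⟨unit, 0, 0, (cls_zero _).symm⟩
  | h P φ p => exact ⟨P, φ, p, rfl⟩
  | hadd x y hx hy =>
    obtain ⟨P, φ, p, rfl⟩ := hx
    obtain ⟨Q, ψ, q, rfl⟩ := hy
    refine ⟨prod P Q, (LinearMap.coprod φ ψ : P × Q →ₗ[ℂ[X]] ℂ[X]), ((p, q) : P × Q), ?_⟩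
    have h1 : cls φ p = cls (P := prod P Q) (LinearMap.coprod φ ψ : P × Q →ₗ[ℂ[X]] ℂ[X])
        ((p, 0) : P × Q) :=
      (cls_map' (Q := prod P Q) ⟨(LinearMap.inl ℂ[X] P Q : P →ₗ[ℂ[X]] P × Q), fun x => by
          refine Prod.ext rfl ?_; exact (map_zero Q.d).symm⟩ _ _ _ _ rfl fun x => by
          change φ x + ψ 0 = φ x; rw [map_zero, add_zero]).symm
    have h2 : cls ψ q = cls (P := prod P Q) (LinearMap.coprod φ ψ : P × Q →ₗ[ℂ[X]] ℂ[X])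
        ((0, q) : P × Q) :=
      (cls_map' (Q := prod P Q) ⟨(LinearMap.inr ℂ[X] P Q : Q →ₗ[ℂ[X]] P × Q), fun x => by
          refine Prod.ext ?_ rfl; exact (map_zero P.d).symm⟩ _ _ _ _ rfl fun x => by
          change φ 0 + ψ x = ψ x; rw [map_zero, zero_add]).symm
    rw [h1, h2]
    refine (cls_add _ _ _).symm.trans (congrArg _ ?_)
    exact Prod.ext (add_zero p) (zero_add q)

/-- The linear map `[φ ⊗ p] ↦ φ (∂ⁿ p)`. -/
def coef (n : ℕ) : FinDual →ₗ[ℂ] ℂ[X] :=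
  lift (fun P φ p => φ (P.d^[n] p))
    (fun _ _ _ _ => rfl) (fun _ _ _ _ => rfl)
    (fun P φ p q => by rw [iterate_map_add, map_add])
    (fun P c φ p => by
      have h : P.d^[n] (c • p) = c • P.d^[n] p := by
        induction n with
        | zero => rfl
        | succ n ih => rw [Function.iterate_succ_apply', ih, d_smul, Function.iterate_succ_apply']
      rw [h, csmul_def, map_smul, smul_eq_mul, Polynomial.smul_eq_C_mul])
    (fun P Q u ψ p => by
      have h : Q.d^[n] (u.toLin p) = u.toLin (P.d^[n] p) := by
        induction n with
        | zero => rfl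
        | succ n ih => rw [Function.iterate_succ_apply', ih, ← u.map_d, Function.iterate_succ_apply']
      rw [h]; rfl)

theorem coef_cls (n : ℕ) {P : DiffMod} (φ : Dual P) (p : P) : coef n (cls φ p) = φ (P.d^[n] p) :=
  lift_cls _ _ _ _ _ _ φ p

/-- The submodule spanned by `p` and its derivatives. -/
def cyclic {P : DiffMod} (p : P) : Submodule ℂ[X] P :=
  Submodule.span ℂ[X] (Set.range fun n => P.d^[n] p)

theorem d_mem_cyclic {P : DiffMod} (p : P) {x : P} (hx : x ∈ cyclic p) : P.d x ∈ cyclic p := by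
  induction hx using Submodule.span_induction with
  | mem x hx =>
    obtain ⟨n, rfl⟩ := hx
    exact Submodule.subset_span ⟨n + 1, Function.iterate_succ_apply' _ _ _⟩
  | zero => rw [map_zero]; exact zero_mem _
  | add x y _ _ hx hy => rw [map_add]; exact add_mem hx hy
  | smul a x hx h =>
    rw [P.leibniz]
    exact add_mem (Submodule.smul_mem _ _ hx) (Submodule.smul_mem _ _ h)

/-- The differential submodule generated by `p`. -/
def cyclicMod {P : DiffMod} (p : P) : DiffMod where
  carrier := cyclic p
  d :=
    { toFun := fun x => ⟨P.d x, d_mem_cyclic p x.2⟩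
      map_zero' := Subtype.ext (map_zero P.d)
      map_add' := fun x y => Subtype.ext (map_add P.d x.1 y.1) }
  leibniz a x := Subtype.ext (P.leibniz a x.1)

theorem eq_zero_of_coef (x : FinDual) (h : ∀ n, coef n x = 0) : x = 0 := by
  obtain ⟨P, φ, p, rfl⟩ := exists_cls x
  let u : Hom (cyclicMod p) P :=
    ⟨((cyclic p).subtype : cyclic p →ₗ[ℂ[X]] P), fun _ => rfl⟩
  have hp : p ∈ cyclic p := Submodule.subset_span ⟨0, rfl⟩
  have h1 : cls φ p = cls (0 : Dual (cyclicMod p)) (⟨p, hp⟩ : cyclic p) :=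
    cls_map' u _ _ _ _ rfl fun x => by
      change φ (x : cyclic p).1 = 0
      have hx := (x : cyclic p).2
      have : cyclic p ≤ LinearMap.ker φ := by
        rw [cyclic, Submodule.span_le]
        rintro _ ⟨n, rfl⟩
        have := h n
        rwa [coef_cls] at this
      exact this hx
  rw [h1]
  exact zero_cls _

theorem coef_s_mul (n : ℕ) (a : ℂ[X]) (x : FinDual) : coef n (s a * x) = a * coef n x := by
  obtain ⟨P, φ, p, rfl⟩ := exists_cls x
  rw [s_mul_cls, coef_cls, coef_cls]; rfl

theorem s_mul_eq_zero {a : ℂ[X]} (ha : a ≠ 0) {x : FinDual} (h : s a * x = 0) : x = 0 :=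
  eq_zero_of_coef x fun n => by
    have := coef_s_mul n a x
    rw [h, map_zero] at this
    exact (mul_eq_zero.1 this.symm).resolve_left ha

theorem t_mul_eq_zero {a : ℂ[X]} (ha : a ≠ 0) {x : FinDual} (h : t a * x = 0) : x = 0 := by
  have h1 : S x = 0 := s_mul_eq_zero ha (by rw [← S_t, ← map_mul, h, map_zero])
  rw [← S_S x, h1, map_zero]

end FinDual

namespace Amalg

/-- An algebra over a principal ideal domain is flat if no nonzero element of the base is a zero
divisor on it. -/
theorem flat_via {B : Type*} [CommRing B] [Algebra ℂ B] (f : ℂ[X] →ₐ[ℂ] B)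
    (h : ∀ a : ℂ[X], a ≠ 0 → ∀ x, f a * x = 0 → x = 0) : Module.Flat ℂ[X] (Via f) := by
  have : Module.IsTorsionFree ℂ[X] (Via f) := by
    refine Module.isTorsionFree_iff_smul_eq_zero.2 fun a x hx => ?_
    by_cases ha : a = 0
    · exact Or.inl ha
    · exact Or.inr (h a ha x hx)
  infer_instance

section

variable {k A B C : Type*} [CommRing k] [CommRing A] [CommRing B] [CommRing C]
  [Algebra k A] [Algebra k B] [Algebra k C]

/-- The map `B ⊗[A] B → C ⊗[A] C` induced by `j : B → C`. -/
def map (j : B →ₐ[k] C) {f g : A →ₐ[k] B} {f' g' : A →ₐ[k] C} (hf : j.comp f = f')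
    (hg : j.comp g = g') : Amalg f g →ₐ[k] Amalg f' g' :=
  lift ((inl f' g').comp j) ((inr f' g').comp j)
    (by rw [AlgHom.comp_assoc, AlgHom.comp_assoc, hf, hg, glue])

theorem map_inl (j : B →ₐ[k] C) {f g : A →ₐ[k] B} {f' g' : A →ₐ[k] C} (hf : j.comp f = f')
    (hg : j.comp g = g') (x : B) : map j hf hg (inl f g x) = inl f' g' (j x) := lift_inl _ _ _ x

theorem map_inr (j : B →ₐ[k] C) {f g : A →ₐ[k] B} {f' g' : A →ₐ[k] C} (hf : j.comp f = f')
    (hg : j.comp g = g') (x : B) : map j hf hg (inr f g x) = inr f' g' (j x) := lift_inr _ _ _ x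

theorem map_injective (j : B →ₐ[k] C) {f g : A →ₐ[k] B} {f' g' : A →ₐ[k] C} (hf : j.comp f = f')
    (hg : j.comp g = g') (hj : Function.Injective j) [Module.Flat A (Via f)]
    [Module.Flat A (Via g')] : Function.Injective (map j hf hg) := by
  let jf : Via f →ₗ[A] Via f' :=
    { toFun := j
      map_add' := map_add j
      map_smul' := fun a x => (map_mul j (f a) x).trans
        (congrArg (· * j x) (DFunLike.congr_fun hf a)) }
  let jg : Via g →ₗ[A] Via g' :=
    { toFun := j
      map_add' := map_add j
      map_smul' := fun a x => (map_mul j (g a) x).trans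
        (congrArg (· * j x) (DFunLike.congr_fun hg a)) }
  have h1 := Module.Flat.lTensor_preserves_injective_linearMap (M := Via f) jg hj
  have h2 := Module.Flat.rTensor_preserves_injective_linearMap (M := Via g') jf hj
  have h3 : ⇑(map j hf hg) = (LinearMap.rTensor (Via g') jf) ∘ (LinearMap.lTensor (Via f) jg) := by
    funext z
    refine TensorProduct.induction_on (motive := fun z => map j hf hg z =
      LinearMap.rTensor (Via g') jf (LinearMap.lTensor (Via f) jg z)) z ?_ (fun b c => ?_)
      fun x y hx hy => ?_
    · rw [map_zero, map_zero]; exact map_zero _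
    · have := tmul_eq f g b c
      unfold tmul at this
      rw [LinearMap.lTensor_tmul, LinearMap.rTensor_tmul]
      refine (congrArg (map j hf hg) this).trans ?_
      refine ((map_mul (map j hf hg) _ _).trans (congrArg₂ (· * ·) (lift_inl _ _ _ _)
        (lift_inr _ _ _ _))).trans ?_
      exact (tmul_eq f' g' (j b) (j c)).symm
    · rw [map_add, map_add]
      exact (map_add (map j hf hg) x y).trans (congrArg₂ (· + ·) hx hy)
  rw [h3]
  exact h2.comp h1

end

end Amalg

namespace HopfAlgebroid

open Amalg

section

variable {k A H : Type*} [CommRing k] [CommRing A] [CommRing H] [Algebra k A] [Algebra k H] {m : ℕ}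

/-- The algebra `H` is generated by the images of `s` and `t`, the entries of the matrix `u`, and
the inverse of its determinant. -/
def Generates (s t : A →ₐ[k] H) (u : Matrix (Fin m) (Fin m) H) : Prop :=
  ∀ L : Subalgebra k H, (∀ a, s a ∈ L) → (∀ a, t a ∈ L) → (∀ i j, u i j ∈ L) →
    (∀ x, x * u.det = 1 → x ∈ L) → L = ⊤

theorem Generates.ext {s t : A →ₐ[k] H} {u : Matrix (Fin m) (Fin m) H} (hG : Generates s t u)
    {R : Type*} [CommRing R] [Algebra k R] {f g : H →ₐ[k] R} (hs : ∀ a, f (s a) = g (s a))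
    (ht : ∀ a, f (t a) = g (t a)) (hu : ∀ i j, f (u i j) = g (u i j)) : f = g := by
  have h := hG (AlgHom.equalizer f g) hs ht hu fun x hx => by
    have hd : f u.det = g u.det := by
      rw [AlgHom.map_det, AlgHom.map_det]
      congr 1
      exact Matrix.ext hu
    change f x = g x
    have h1 : f x * f u.det = 1 := by rw [← map_mul, hx, map_one]
    have h2 : g x * f u.det = 1 := by rw [hd, ← map_mul, hx, map_one]
    calc f x = f x * (g x * f u.det) := by rw [h2, mul_one]
      _ = g x * (f x * f u.det) := by ring
      _ = g x := by rw [h1, mul_one]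
  exact AlgHom.ext fun x => by
    have : x ∈ AlgHom.equalizer f g := h ▸ Algebra.mem_top
    exact this

/-- The Hopf algebroid structure on an algebra generated by a grouplike matrix `u` over
`A ⊗[k] A`: `Δ (u i j) = ∑ u i l ⊗ u l j`, `ε (u i j) = δ_ij`, and `S u` is inverse to `u`. -/
def ofMatrix (s t : A →ₐ[k] H) (u : Matrix (Fin m) (Fin m) H) (hG : Generates s t u)
    (ε : H →ₐ[k] A) (Δ : H →ₐ[k] Amalg t s) (S : H →ₐ[k] H)
    (ε_s : ∀ a, ε (s a) = a) (ε_t : ∀ a, ε (t a) = a)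
    (ε_u : ∀ i j, ε (u i j) = (1 : Matrix (Fin m) (Fin m) A) i j)
    (Δ_s : ∀ a, Δ (s a) = inl t s (s a)) (Δ_t : ∀ a, Δ (t a) = inr t s (t a))
    (Δ_u : ∀ i j, Δ (u i j) = ∑ l, inl t s (u i l) * inr t s (u l j))
    (S_s : ∀ a, S (s a) = t a) (S_t : ∀ a, S (t a) = s a)
    (S_u : S.mapMatrix u * u = 1) : HopfAlgebroid k A H where
  s := s
  t := t
  ε := ε
  Δ := Δ
  S := S
  ε_s := AlgHom.ext ε_s
  ε_t := AlgHom.ext ε_t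
  Δ_s := AlgHom.ext Δ_s
  Δ_t := AlgHom.ext Δ_t
  S_s := AlgHom.ext S_s
  S_t := AlgHom.ext S_t
  counit_left := hG.ext
    (fun a => by simp [Δ_s, ε_s])
    (fun a => by simp [Δ_t])
    (fun i j => by
      simp only [AlgHom.comp_apply, Δ_u, map_sum, map_mul, lift_inl, lift_inr, ε_u, AlgHom.id_apply]
      rw [Finset.sum_eq_single i]
      · simp
      · intro l _ hl; simp [Matrix.one_apply_ne hl.symm]
      · simp)
  counit_right := hG.ext
    (fun a => by simp [Δ_s])
    (fun a => by simp [Δ_t, ε_t])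
    (fun i j => by
      simp only [AlgHom.comp_apply, Δ_u, map_sum, map_mul, lift_inl, lift_inr, ε_u, AlgHom.id_apply]
      rw [Finset.sum_eq_single j]
      · simp
      · intro l _ hl; simp [Matrix.one_apply_ne hl]
      · simp)
  coassoc := hG.ext
    (fun a => by simp [Δ_s])
    (fun a => by simp [Δ_t])
    (fun i j => by
      simp only [AlgHom.comp_apply, Δ_u, map_sum, map_mul, lift_inl, lift_inr, Finset.sum_mul,
        Finset.mul_sum]
      rw [Finset.sum_comm]
      refine Finset.sum_congr rfl fun l _ => Finset.sum_congr rfl fun n _ => ?_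
      rw [mul_assoc])
  antipode_left := hG.ext
    (fun a => by simp [Δ_s, S_s, ε_s])
    (fun a => by simp [Δ_t, ε_t])
    (fun i j => by
      simp only [AlgHom.comp_apply, Δ_u, map_sum, map_mul, lift_inl, lift_inr, ε_u, AlgHom.id_apply]
      have := congrFun (congrFun S_u i) j
      rw [Matrix.mul_apply] at this
      refine this.trans ?_
      rw [Matrix.one_apply, Matrix.one_apply]; split_ifs <;> simp)
  antipode_right := hG.ext
    (fun a => by simp [Δ_s, ε_s])
    (fun a => by simp [Δ_t, S_t, ε_t])
    (fun i j => by
      simp only [AlgHom.comp_apply, Δ_u, map_sum, map_mul, lift_inl, lift_inr, ε_u, AlgHom.id_apply]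
      have h2 : u * S.mapMatrix u = 1 := mul_eq_one_comm.1 S_u
      have := congrFun (congrFun h2 i) j
      rw [Matrix.mul_apply] at this
      refine this.trans ?_
      rw [Matrix.one_apply, Matrix.one_apply]; split_ifs <;> simp)

end

end HopfAlgebroid

/-- The polynomial ring `(A ⊗ A)[X_ij]` with `A = ℂ[X]` and `1 ≤ i, j ≤ m`. -/
abbrev MatPoly (m : ℕ) : Type := MvPolynomial (Fin m × Fin m) (ℂ[X] ⊗[ℂ] ℂ[X])

/-- The generic matrix `(X_ij)`. -/
def genericMat (m : ℕ) : Matrix (Fin m) (Fin m) (MatPoly m) :=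
  Matrix.of fun i j => MvPolynomial.X (i, j)

/-- The ring `(A ⊗ A)[X_ij, det⁻¹]`. -/
def GLRing (m : ℕ) : Type := Localization.Away (genericMat m).det

instance (m : ℕ) : CommRing (GLRing m) :=
  inferInstanceAs (CommRing (Localization.Away (genericMat m).det))
instance (m : ℕ) : Algebra ℂ (GLRing m) :=
  inferInstanceAs (Algebra ℂ (Localization.Away (genericMat m).det))
instance (m : ℕ) : Algebra (MatPoly m) (GLRing m) :=
  inferInstanceAs (Algebra (MatPoly m) (Localization.Away (genericMat m).det))
instance (m : ℕ) : IsScalarTower ℂ (MatPoly m) (GLRing m) :=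
  inferInstanceAs (IsScalarTower ℂ (MatPoly m) (Localization.Away (genericMat m).det))
instance (m : ℕ) : IsLocalization (Submonoid.powers (genericMat m).det) (GLRing m) :=
  inferInstanceAs (IsLocalization _ (Localization.Away (genericMat m).det))

namespace GLRing

open Amalg

variable {m : ℕ}

/-- The map `(A ⊗ A)[X_ij] → (A ⊗ A)[X_ij, det⁻¹]`. -/
def ofPolyRing (m : ℕ) : MatPoly m →ₐ[ℂ] GLRing m :=
  IsScalarTower.toAlgHom ℂ (MatPoly m) (GLRing m)

/-- The matrix `(X_ij)` over `(A ⊗ A)[X_ij, det⁻¹]`. -/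
def X (m : ℕ) : Matrix (Fin m) (Fin m) (GLRing m) := (ofPolyRing m).mapMatrix (genericMat m)

/-- The source `a ↦ a ⊗ 1`. -/
def s (m : ℕ) : ℂ[X] →ₐ[ℂ] GLRing m :=
  (ofPolyRing m).comp ((IsScalarTower.toAlgHom ℂ (ℂ[X] ⊗[ℂ] ℂ[X]) (MatPoly m)).comp
    Algebra.TensorProduct.includeLeft)

/-- The target `a ↦ 1 ⊗ a`. -/
def t (m : ℕ) : ℂ[X] →ₐ[ℂ] GLRing m :=
  (ofPolyRing m).comp ((IsScalarTower.toAlgHom ℂ (ℂ[X] ⊗[ℂ] ℂ[X]) (MatPoly m)).comp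
    Algebra.TensorProduct.includeRight)

theorem X_apply (i j : Fin m) : X m i j = ofPolyRing m (MvPolynomial.X (i, j)) := rfl

theorem det_X : (X m).det = ofPolyRing m (genericMat m).det := by
  have h := AlgHom.map_det (ofPolyRing m) (genericMat m)
  unfold X
  rw [h]

theorem isUnit_det : IsUnit (X m).det := by
  rw [det_X]
  exact IsLocalization.map_units (GLRing m)
    (⟨_, Submonoid.mem_powers _⟩ : Submonoid.powers (genericMat m).det)

theorem generates (m : ℕ) : HopfAlgebroid.Generates (s m) (t m) (X m) := by
  intro L hs ht hX hinv
  have h1 : ∀ p : MatPoly m, ofPolyRing m p ∈ L := fun p => by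
    induction p using MvPolynomial.induction_on with
    | C z =>
      induction z using TensorProduct.induction_on with
      | zero => rw [map_zero, map_zero]; exact zero_mem L
      | add x y hx hy => rw [map_add, map_add]; exact add_mem hx hy
      | tmul a b =>
        have : (a ⊗ₜ[ℂ] b : ℂ[X] ⊗[ℂ] ℂ[X]) = (a ⊗ₜ[ℂ] 1) * (1 ⊗ₜ[ℂ] b) := by
          rw [Algebra.TensorProduct.tmul_mul_tmul, mul_one, one_mul]
        rw [this, map_mul, map_mul]
        exact mul_mem (hs a) (ht b)
    | add p q hp hq => rw [map_add]; exact add_mem hp hq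
    | mul_X p n hp => rw [map_mul]; exact mul_mem hp (hX n.1 n.2)
  refine eq_top_iff.2 fun x _ => ?_
  obtain ⟨p, ⟨_, n, rfl⟩, rfl⟩ := IsLocalization.exists_mk'_eq
    (Submonoid.powers (genericMat m).det) x
  obtain ⟨w, hw⟩ := isUnit_det (m := m)
  have hwL : (↑w⁻¹ : GLRing m) ∈ L := hinv _ (by rw [← hw]; exact w.inv_mul)
  have h2 : IsLocalization.mk' (GLRing m) p (⟨(genericMat m).det ^ n, n, rfl⟩ :
      Submonoid.powers (genericMat m).det) = ofPolyRing m p * (↑w⁻¹ : GLRing m) ^ n := by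
    rw [IsLocalization.mk'_eq_iff_eq_mul]
    change ofPolyRing m p = _ * ofPolyRing m ((genericMat m).det ^ n)
    rw [map_pow, ← det_X, ← hw, mul_assoc, ← mul_pow, w.inv_mul, one_pow, mul_one]
  rw [h2]
  exact mul_mem (h1 p) (pow_mem hwL n)

section

variable {R : Type*} [CommRing R] [Algebra ℂ R]

/-- The homomorphism `(A ⊗ A)[X_ij] → R` given by two homomorphisms `x, y : A → R` and a matrix. -/
def polyLift (x y : ℂ[X] →ₐ[ℂ] R) (a : Matrix (Fin m) (Fin m) R) : MatPoly m →ₐ[ℂ] R :=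
  MvPolynomial.aevalTower (Algebra.TensorProduct.lift x y fun _ _ => Commute.all _ _)
    fun ij => a ij.1 ij.2

theorem polyLift_generic (x y : ℂ[X] →ₐ[ℂ] R) (a : Matrix (Fin m) (Fin m) R) :
    (polyLift x y a).mapMatrix (genericMat m) = a :=
  Matrix.ext fun _ _ => MvPolynomial.aevalTower_X _ _ _

/-- The homomorphism `(A ⊗ A)[X_ij, det⁻¹] → R` given by two homomorphisms `x, y : A → R` and an
invertible matrix `a` over `R`. -/
def lift (x y : ℂ[X] →ₐ[ℂ] R) (a : Matrix (Fin m) (Fin m) R) (ha : IsUnit a.det) :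
    GLRing m →ₐ[ℂ] R :=
  IsLocalization.liftAlgHom (M := Submonoid.powers (genericMat m).det) (f := polyLift x y a) (by
    rintro ⟨_, n, rfl⟩
    have h := AlgHom.map_det (polyLift x y a) (genericMat m)
    rw [polyLift_generic] at h
    refine (congrArg IsUnit (map_pow (polyLift x y a) _ n)).mpr ?_
    rw [h]
    exact ha.pow n)

variable (x y : ℂ[X] →ₐ[ℂ] R) (a : Matrix (Fin m) (Fin m) R) (ha : IsUnit a.det)

theorem lift_ofPolyRing (p : MatPoly m) : lift x y a ha (ofPolyRing m p) =
    polyLift x y a p :=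
  IsLocalization.lift_eq _ p

@[simp] theorem lift_s (b : ℂ[X]) : lift x y a ha (s m b) = x b := by
  refine (lift_ofPolyRing x y a ha _).trans ?_
  refine (MvPolynomial.aevalTower_C _ _ _).trans ?_
  simp

@[simp] theorem lift_t (b : ℂ[X]) : lift x y a ha (t m b) = y b := by
  refine (lift_ofPolyRing x y a ha _).trans ?_
  refine (MvPolynomial.aevalTower_C _ _ _).trans ?_
  simp

@[simp] theorem lift_X (i j : Fin m) : lift x y a ha (X m i j) = a i j :=
  (lift_ofPolyRing x y a ha _).trans (MvPolynomial.aevalTower_X _ _ _)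

end

/-- The Hopf algebroid `(A, (A ⊗ A)[X_ij, det⁻¹])`: `Δ X_ij = ∑ X_il ⊗ X_lj`, `ε X_ij = δ_ij`,
`S (X_ij) = (X⁻¹)_ij`. -/
def hopf (m : ℕ) : HopfAlgebroid ℂ ℂ[X] (GLRing m) :=
  HopfAlgebroid.ofMatrix (s m) (t m) (X m) (generates m)
    (lift (AlgHom.id ℂ _) (AlgHom.id ℂ _) 1 (by rw [Matrix.det_one]; exact isUnit_one))
    (lift ((inl (t m) (s m)).comp (s m)) ((inr (t m) (s m)).comp (t m))
      ((inl (t m) (s m)).mapMatrix (X m) * (inr (t m) (s m)).mapMatrix (X m)) (by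
        rw [Matrix.det_mul, ← AlgHom.map_det, ← AlgHom.map_det]
        exact (isUnit_det.map _).mul (isUnit_det.map _)))
    (lift (t m) (s m) (X m)⁻¹ (Matrix.isUnit_nonsing_inv_det _ isUnit_det))
    (by simp) (by simp) (by simp) (by simp) (by simp)
    (fun i j => by rw [lift_X, Matrix.mul_apply]; rfl) (by simp) (by simp)
    (by
      refine Eq.trans (congrArg (· * X m) ?_) (Matrix.nonsing_inv_mul (X m) isUnit_det)
      exact Matrix.ext fun i j => lift_X _ _ _ (Matrix.isUnit_nonsing_inv_det _ isUnit_det) i j)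

end GLRing

section

open Amalg FinDual

variable {M : DiffMod} {m : ℕ} (e : Module.Basis (Fin m) ℂ[X] M)

/-- The matrix `u_ij = [e_i^* ⊗ e_j]` over `U°`. -/
def coeffMat : Matrix (Fin m) (Fin m) FinDual := Matrix.of fun i j => cls (e.coord i) (e j)

/-- The element `det_M` of `U°`. -/
def detM : FinDual := (coeffMat e).det

theorem coeffMat_mul_S : coeffMat e * S.mapMatrix (coeffMat e) = 1 := by
  refine Matrix.ext fun i j => ?_
  have h : Amalg.lift (f := t) (g := s) (AlgHom.id ℂ FinDual) S (AlgHom.ext fun a => (S_s a).symm)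
      (Δ (cls (e.coord i) (e j))) = s (ε (cls (e.coord i) (e j))) :=
    DFunLike.congr_fun hopf.antipode_right _
  rw [lift_Δ _ _ _ e, ε_cls] at h
  rw [Matrix.mul_apply]
  refine h.trans ?_
  rw [Module.Basis.coord_apply, Module.Basis.repr_self, Matrix.one_apply, Finsupp.single_apply]
  split_ifs with h1 h2 h2
  · exact map_one s
  · exact absurd h1.symm h2
  · exact absurd h2.symm h1
  · exact map_zero s

theorem detM_mul_S : detM e * S (detM e) = 1 := by
  rw [detM, AlgHom.map_det, ← Matrix.det_mul, coeffMat_mul_S, Matrix.det_one]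

/-- The `(A ⊗ A)`-subalgebra `U°_(M)` of `U°` generated by the image of `M^* ⊗ M` and the inverse
of `det_M`. -/
def galoisAlg : Subalgebra ℂ FinDual :=
  Algebra.adjoin ℂ (Set.range s ∪ Set.range t ∪ {x | ∃ (φ : Dual M) (p : M), x = cls φ p} ∪
    {x | x * detM e = 1})

namespace galoisAlg

theorem s_mem (a : ℂ[X]) : FinDual.s a ∈ galoisAlg e :=
  Algebra.subset_adjoin (Or.inl (Or.inl (Or.inl ⟨a, rfl⟩)))

theorem t_mem (a : ℂ[X]) : FinDual.t a ∈ galoisAlg e :=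
  Algebra.subset_adjoin (Or.inl (Or.inl (Or.inr ⟨a, rfl⟩)))

theorem cls_mem (φ : Dual M) (p : M) : cls φ p ∈ galoisAlg e :=
  Algebra.subset_adjoin (Or.inl (Or.inr ⟨φ, p, rfl⟩))

theorem inv_mem {x : FinDual} (hx : x * detM e = 1) : x ∈ galoisAlg e :=
  Algebra.subset_adjoin (Or.inr hx)

theorem le_of_gens {L : Subalgebra ℂ FinDual} (hs : ∀ a, FinDual.s a ∈ L)
    (ht : ∀ a, FinDual.t a ∈ L) (hu : ∀ i j, coeffMat e i j ∈ L)
    (hinv : ∀ x, x * detM e = 1 → x ∈ L) : galoisAlg e ≤ L := by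
  refine Algebra.adjoin_le ?_
  rintro x (((⟨a, rfl⟩ | ⟨a, rfl⟩) | ⟨φ, p, rfl⟩) | hx)
  · exact hs a
  · exact ht a
  · rw [dual_eq_sum e φ, sum_cls]
    refine sum_mem fun i _ => ?_
    rw [← s_mul_cls, ← e.sum_repr p, cls_sum]
    refine mul_mem (hs _) (sum_mem fun j _ => ?_)
    rw [← t_mul_cls]
    exact mul_mem (ht _) (hu i j)
  · exact hinv x hx

/-- The source. -/
def s : ℂ[X] →ₐ[ℂ] galoisAlg e := FinDual.s.codRestrict (galoisAlg e) (s_mem e)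

/-- The target. -/
def t : ℂ[X] →ₐ[ℂ] galoisAlg e := FinDual.t.codRestrict (galoisAlg e) (t_mem e)

/-- The matrix `u_ij = [e_i^* ⊗ e_j]` over `U°_(M)`. -/
def u : Matrix (Fin m) (Fin m) (galoisAlg e) :=
  Matrix.of fun i j => ⟨cls (e.coord i) (e j), cls_mem e _ _⟩

theorem val_comp_s : (galoisAlg e).val.comp (s e) = FinDual.s := rfl

theorem val_comp_t : (galoisAlg e).val.comp (t e) = FinDual.t := rfl

theorem val_u (i j : Fin m) : (galoisAlg e).val (u e i j) = coeffMat e i j := rfl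

theorem val_mapMatrix_u : (galoisAlg e).val.mapMatrix (u e) = coeffMat e := rfl

theorem val_det : (galoisAlg e).val (u e).det = detM e := by
  rw [AlgHom.map_det]; rfl

theorem generates : HopfAlgebroid.Generates (s e) (t e) (u e) := by
  intro L hs ht hu hinv
  have h : galoisAlg e ≤ L.map (galoisAlg e).val :=
    le_of_gens e (fun a => ⟨_, hs a, rfl⟩) (fun a => ⟨_, ht a, rfl⟩) (fun i j => ⟨_, hu i j, rfl⟩)
      fun x hx => by
        refine ⟨⟨x, inv_mem e hx⟩, hinv _ (Subtype.ext ?_), rfl⟩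
        rw [← val_det e] at hx
        exact hx
  refine eq_top_iff.2 fun x _ => ?_
  obtain ⟨y, hy, hyx⟩ := h x.2
  exact (Subtype.ext hyx : y = x) ▸ hy

theorem flat_t : Module.Flat ℂ[X] (Via (t e)) :=
  flat_via _ fun _ ha _ hx => Subtype.ext (FinDual.t_mul_eq_zero ha (congrArg Subtype.val hx))

theorem flat_s : Module.Flat ℂ[X] (Via FinDual.s) :=
  flat_via _ fun _ ha _ hx => FinDual.s_mul_eq_zero ha hx

/-- The inclusion `U°_(M) ⊗[A] U°_(M) → U° ⊗[A] U°`. -/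
def incl₂ : Amalg (t e) (s e) →ₐ[ℂ] Amalg FinDual.t FinDual.s :=
  Amalg.map (galoisAlg e).val (val_comp_t e) (val_comp_s e)

theorem incl₂_injective : Function.Injective (incl₂ e) :=
  haveI := flat_t e
  haveI := flat_s
  Amalg.map_injective _ _ _ Subtype.val_injective

theorem incl₂_inl (x : galoisAlg e) : incl₂ e (inl (t e) (s e) x) =
    inl FinDual.t FinDual.s x := map_inl _ _ _ x

theorem incl₂_inr (x : galoisAlg e) : incl₂ e (inr (t e) (s e) x) =
    inr FinDual.t FinDual.s x := map_inr _ _ _ x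

theorem Δ_coeffMat : FinDual.Δ.mapMatrix (coeffMat e) =
    (inl FinDual.t FinDual.s).mapMatrix (coeffMat e) *
      (inr FinDual.t FinDual.s).mapMatrix (coeffMat e) :=
  Matrix.ext fun i j => by
    rw [Matrix.mul_apply]
    exact Δ_cls e (e.coord i) (e j)

theorem Δ_detM : FinDual.Δ (detM e) =
    inl FinDual.t FinDual.s (detM e) * inr FinDual.t FinDual.s (detM e) := by
  unfold detM
  rw [AlgHom.map_det, Δ_coeffMat, Matrix.det_mul, ← AlgHom.map_det, ← AlgHom.map_det]

theorem Δ_mem (x : galoisAlg e) : FinDual.Δ x ∈ (incl₂ e).range := by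
  have h : galoisAlg e ≤ (incl₂ e).range.comap FinDual.Δ := by
    refine le_of_gens e (fun a => ?_) (fun a => ?_) (fun i j => ?_) (fun x hx => ?_)
    · exact ⟨inl _ _ (s e a), (incl₂_inl e _).trans (ΔLin_s a).symm⟩
    · exact ⟨inr _ _ (t e a), (incl₂_inr e _).trans (ΔLin_t a).symm⟩
    · refine ⟨∑ l, inl _ _ (u e i l) * inr _ _ (u e l j), ?_⟩
      refine Eq.trans ?_ (Δ_cls e (e.coord i) (e j)).symm
      refine (map_sum (incl₂ e) _ _).trans (Finset.sum_congr rfl fun l _ => ?_)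
      exact (map_mul (incl₂ e) _ _).trans (congrArg₂ (· * ·) (incl₂_inl e _) (incl₂_inr e _))
    · refine ⟨inl _ _ ⟨x, inv_mem e hx⟩ * inr _ _ ⟨x, inv_mem e hx⟩, ?_⟩
      refine (map_mul (incl₂ e) _ _).trans
        ((congrArg₂ (· * ·) (incl₂_inl e _) (incl₂_inr e _)).trans ?_)
      change inl FinDual.t FinDual.s x * inr FinDual.t FinDual.s x = FinDual.Δ x
      have h1 : FinDual.Δ x * FinDual.Δ (detM e) = 1 := by rw [← map_mul, hx, map_one]
      have h2 : inl FinDual.t FinDual.s x * inr FinDual.t FinDual.s x * FinDual.Δ (detM e) = 1 := by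
        rw [Δ_detM, mul_mul_mul_comm, ← map_mul, ← map_mul, hx, map_one, map_one, mul_one]
      calc _ = inl FinDual.t FinDual.s x * inr FinDual.t FinDual.s x *
            (FinDual.Δ x * FinDual.Δ (detM e)) := by rw [h1, mul_one]
        _ = FinDual.Δ x * (inl FinDual.t FinDual.s x * inr FinDual.t FinDual.s x *
            FinDual.Δ (detM e)) := by ring
        _ = FinDual.Δ x := by rw [h2, mul_one]
  exact h x.2

/-- The comultiplication: the restriction of that of `U°`. -/
def Δ : galoisAlg e →ₐ[ℂ] Amalg (t e) (s e) :=
  (AlgEquiv.ofInjective (incl₂ e) (incl₂_injective e)).symm.toAlgHom.comp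
    ((FinDual.Δ.comp (galoisAlg e).val).codRestrict (incl₂ e).range (Δ_mem e))

theorem incl₂_Δ (x : galoisAlg e) : incl₂ e (Δ e x) = FinDual.Δ x :=
  congrArg Subtype.val (AlgEquiv.apply_symm_apply
    (AlgEquiv.ofInjective (incl₂ e) (incl₂_injective e)) ⟨FinDual.Δ x, Δ_mem e x⟩)

theorem S_mem (x : galoisAlg e) : FinDual.S x ∈ galoisAlg e := by
  have h : galoisAlg e ≤ (galoisAlg e).comap FinDual.S := by
    refine le_of_gens e (fun a => ?_) (fun a => ?_) (fun i j => ?_) (fun x hx => ?_)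
    · change FinDual.S (FinDual.s a) ∈ galoisAlg e
      rw [FinDual.S_s]; exact t_mem e a
    · change FinDual.S (FinDual.t a) ∈ galoisAlg e
      rw [FinDual.S_t]; exact s_mem e a
    · change FinDual.S.mapMatrix (coeffMat e) i j ∈ galoisAlg e
      have h1 : FinDual.S.mapMatrix (coeffMat e) =
          FinDual.S (detM e) • (coeffMat e).adjugate := by
        have h2 := congrArg ((coeffMat e).adjugate * ·) (coeffMat_mul_S e)
        simp only [← mul_assoc, Matrix.adjugate_mul, mul_one] at h2
        rw [← h2, Matrix.smul_mul, one_mul, smul_smul]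
        change _ = (FinDual.S (detM e) * detM e) • _
        rw [mul_comm, detM_mul_S, one_smul]
      rw [h1, ← val_mapMatrix_u, ← AlgHom.map_adjugate]
      exact mul_mem (inv_mem e (by rw [mul_comm, detM_mul_S])) ((u e).adjugate i j).2
    · change FinDual.S x ∈ galoisAlg e
      have h1 : FinDual.S x * FinDual.S (detM e) = 1 := by rw [← map_mul, hx, map_one]
      have h2 : FinDual.S x = detM e := by
        calc FinDual.S x = FinDual.S x * (detM e * FinDual.S (detM e)) := by
              rw [detM_mul_S, mul_one]
          _ = (FinDual.S x * FinDual.S (detM e)) * detM e := by ring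
          _ = detM e := by rw [h1, one_mul]
      rw [h2, ← val_det e]
      exact (u e).det.2
  exact h x.2

/-- The antipode: the restriction of that of `U°`. -/
def S : galoisAlg e →ₐ[ℂ] galoisAlg e :=
  (FinDual.S.comp (galoisAlg e).val).codRestrict (galoisAlg e) (S_mem e)

/-- The Hopf algebroid `(A, U°_(M))`, with the structure maps of `(A, U°)`. -/
def hopf : HopfAlgebroid ℂ ℂ[X] (galoisAlg e) :=
  HopfAlgebroid.ofMatrix (s e) (t e) (u e) (generates e)
    (FinDual.ε.comp (galoisAlg e).val) (Δ e) (S e)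
    FinDual.ε_s FinDual.ε_t
    (fun i j => by
      refine (ε_cls (e.coord i) (e j)).trans ?_
      rw [Module.Basis.coord_apply, Module.Basis.repr_self, Matrix.one_apply, Finsupp.single_apply]
      simp only [eq_comm])
    (fun a => incl₂_injective e ((incl₂_Δ e _).trans
      ((ΔLin_s a).trans (incl₂_inl e (s e a)).symm)))
    (fun a => incl₂_injective e ((incl₂_Δ e _).trans
      ((ΔLin_t a).trans (incl₂_inr e (t e a)).symm)))
    (fun i j => incl₂_injective e ((incl₂_Δ e _).trans
      ((Δ_cls e (e.coord i) (e j)).trans (by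
        refine ((map_sum (incl₂ e) _ _).trans (Finset.sum_congr rfl fun l _ => ?_)).symm
        exact (map_mul (incl₂ e) _ _).trans
          (congrArg₂ (· * ·) (incl₂_inl e _) (incl₂_inr e _))))))
    (fun a => Subtype.ext (FinDual.S_s a)) (fun a => Subtype.ext (FinDual.S_t a))
    (by
      refine mul_eq_one_comm.1 (Matrix.ext fun i j => Subtype.ext ?_)
      have h := congrFun (congrFun (coeffMat_mul_S e) i) j
      rw [Matrix.mul_apply] at h ⊢
      refine Eq.trans ?_ (h.trans ?_)
      · exact map_sum (galoisAlg e).val _ _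
      · rw [Matrix.one_apply, Matrix.one_apply]; split_ifs <;> rfl)

/-- `(A, U°_(M))` is a Hopf subalgebroid of `(A, U°)`. -/
def inclusion : HopfAlgebroid.Hom (hopf e) FinDual.hopf where
  toAlgHom := (galoisAlg e).val
  map_s := rfl
  map_t := rfl
  map_ε := rfl
  map_Δ := AlgHom.ext fun x => (incl₂_Δ e x).symm
  map_S := rfl

end galoisAlg

end

/-- The objects of the groupoid `𝔸¹ × GL_m(ℂ) × 𝔸¹`: the points of the affine line. -/
@[ext] structure InducedGL (m : ℕ) where
  pt : ℂ

namespace InducedGL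

variable {m : ℕ}

/-- An arrow `(y, a, x)` from `x` to `y` of the groupoid `𝔸¹ × GL_m(ℂ) × 𝔸¹`. -/
@[ext] structure Arr (x y : InducedGL m) where
  mat : GL (Fin m) ℂ

/-- The groupoid `𝔸¹ × GL_m(ℂ) × 𝔸¹`, induced from the group `GL_m(ℂ)` along the map from `𝔸¹` to
a point: an arrow `(x, a, y)` has source `y` and target `x`, `(x, a, y) (y, b, z) = (x, a b, z)`,
and `(x, a, y)⁻¹ = (y, a⁻¹, x)`. -/
instance : CategoryTheory.Groupoid (InducedGL m) where
  Hom x y := Arr x y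
  id _ := ⟨1⟩
  comp f g := ⟨g.mat * f.mat⟩
  inv f := ⟨f.mat⁻¹⟩
  id_comp _ := Arr.ext (mul_one _)
  comp_id _ := Arr.ext (one_mul _)
  assoc _ _ _ := Arr.ext (mul_assoc _ _ _).symm
  inv_comp _ := Arr.ext (mul_inv_cancel _)
  comp_inv _ := Arr.ext (inv_mul_cancel _)

end InducedGL

/-- Zariski closed subsets of `GL_m(ℂ)`: the zero sets of families of polynomials in the matrix
entries. -/
def IsZariskiClosed {m : ℕ} (Z : Set (GL (Fin m) ℂ)) : Prop :=
  ∃ I : Set (MvPolynomial (Fin m × Fin m) ℂ),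
    Z = {g : GL (Fin m) ℂ | ∀ p ∈ I,
      MvPolynomial.eval (fun ij => (g : Matrix (Fin m) (Fin m) ℂ) ij.1 ij.2) p = 0}

end DiffGalois

end

/-!
Both Hopf algebroids are generated over `A ⊗ A` by the entries of a matrix `u` with `ε u = 1` and
`Δ u_ij = ∑ u_il ⊗ u_lj`, together with the inverse of its determinant. The antipode axiom makes
`S u` inverse to `u`, so a homomorphism of algebras which respects source, target and the
distinguished matrices respects all of the structure: this gives `Φ_M`, which is surjective because
its image contains the generators.

Evaluating the matrix `u` at the points of such a Hopf algebroid turns the formulas for `ε` and `Δ`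
into functoriality with values in `𝔸¹ × GL_m(ℂ) × 𝔸¹`. An arrow is determined by its source, its
target and its matrix because these are its values on generators. A matrix `a ∈ GL_m(ℂ)` comes from
an arrow `x → x` if and only if the homomorphism `(A ⊗ A)[X_ij, det⁻¹] → ℂ` given by `x`, `x` and
`a` kills the kernel of `Φ_M`. Clearing denominators, this is a condition on the polynomials in
`(A ⊗ A)[X_ij]` killed by `Φ_M`; specialising their coefficients along `x ⊗ x` yields polynomials
over `ℂ` whose common zeros in `GL_m(ℂ)` are the image of the isotropy group.
-/

noncomputable section

namespace DiffGalois

/-! ### Multiplicative matrices over a Hopf algebroid -/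

namespace HopfAlgebroid

open Amalg

variable {k A H K : Type*} [CommRing k] [CommRing A] [CommRing H] [CommRing K] [Algebra k A]
  [Algebra k H] [Algebra k K] {m : ℕ}

/-- A matrix over a Hopf algebroid is multiplicative if its entries are the coefficients of a
comodule: `ε (u i j) = δ_ij` and `Δ (u i j) = ∑ u i l ⊗ u l j`. -/
structure IsMultiplicative (ℋ : HopfAlgebroid k A H) (u : Matrix (Fin m) (Fin m) H) : Prop where
  ε_apply : ∀ i j, ℋ.ε (u i j) = (1 : Matrix (Fin m) (Fin m) A) i j
  Δ_apply : ∀ i j, ℋ.Δ (u i j) = ∑ l, inl ℋ.t ℋ.s (u i l) * inr ℋ.t ℋ.s (u l j)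

namespace IsMultiplicative

variable {ℋ : HopfAlgebroid k A H} {𝒦 : HopfAlgebroid k A K}
  {u : Matrix (Fin m) (Fin m) H} {v : Matrix (Fin m) (Fin m) K}

theorem S_mul (hu : ℋ.IsMultiplicative u) : ℋ.S.mapMatrix u * u = 1 := by
  refine Matrix.ext fun i j => ?_
  have h := DFunLike.congr_fun ℋ.antipode_left (u i j)
  simp only [AlgHom.comp_apply, hu.Δ_apply, map_sum, map_mul, lift_inl, lift_inr, hu.ε_apply,
    AlgHom.id_apply] at h
  rw [Matrix.mul_apply]
  refine h.trans ?_
  rw [Matrix.one_apply, Matrix.one_apply]; split_ifs <;> simp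

theorem isUnit_det (hu : ℋ.IsMultiplicative u) : IsUnit u.det :=
  (Matrix.isUnit_iff_isUnit_det u).1
    (IsUnit.of_mul_eq_one_right _ hu.S_mul)

/-- Compatibility with the structure maps needs to be checked on generators only; for the antipode
it follows from the uniqueness of inverse matrices. -/
def homOfGenerates (hu : ℋ.IsMultiplicative u) (hv : 𝒦.IsMultiplicative v)
    (hG : Generates ℋ.s ℋ.t u) (f : H →ₐ[k] K) (hs : f.comp ℋ.s = 𝒦.s) (ht : f.comp ℋ.t = 𝒦.t)
    (huv : ∀ i j, f (u i j) = v i j) : Hom ℋ 𝒦 :=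
  have hs' (a : A) : f (ℋ.s a) = 𝒦.s a := DFunLike.congr_fun hs a
  have ht' (a : A) : f (ℋ.t a) = 𝒦.t a := DFunLike.congr_fun ht a
  { toAlgHom := f
    map_s := hs
    map_t := ht
    map_ε := hG.ext
      (fun a => by
        rw [AlgHom.comp_apply, hs']
        exact (DFunLike.congr_fun 𝒦.ε_s a).trans (DFunLike.congr_fun ℋ.ε_s a).symm)
      (fun a => by
        rw [AlgHom.comp_apply, ht']
        exact (DFunLike.congr_fun 𝒦.ε_t a).trans (DFunLike.congr_fun ℋ.ε_t a).symm)
      (fun i j => by rw [AlgHom.comp_apply, huv, hu.ε_apply, hv.ε_apply])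
    map_Δ := hG.ext
      (fun a => by
        have h1 : ℋ.Δ (ℋ.s a) = inl ℋ.t ℋ.s (ℋ.s a) := DFunLike.congr_fun ℋ.Δ_s a
        have h2 : 𝒦.Δ (𝒦.s a) = inl 𝒦.t 𝒦.s (𝒦.s a) := DFunLike.congr_fun 𝒦.Δ_s a
        simp only [AlgHom.comp_apply, h1, h2, hs', lift_inl])
      (fun a => by
        have h1 : ℋ.Δ (ℋ.t a) = inr ℋ.t ℋ.s (ℋ.t a) := DFunLike.congr_fun ℋ.Δ_t a
        have h2 : 𝒦.Δ (𝒦.t a) = inr 𝒦.t 𝒦.s (𝒦.t a) := DFunLike.congr_fun 𝒦.Δ_t a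
        simp only [AlgHom.comp_apply, h1, h2, ht', lift_inr])
      (fun i j => by
        simp only [AlgHom.comp_apply, hu.Δ_apply, hv.Δ_apply, huv, map_sum, map_mul, lift_inl,
          lift_inr])
    map_S := hG.ext
      (fun a => by
        have h1 : ℋ.S (ℋ.s a) = ℋ.t a := DFunLike.congr_fun ℋ.S_s a
        have h2 : 𝒦.S (𝒦.s a) = 𝒦.t a := DFunLike.congr_fun 𝒦.S_s a
        simp only [AlgHom.comp_apply, h1, h2, hs', ht'])
      (fun a => by
        have h1 : ℋ.S (ℋ.t a) = ℋ.s a := DFunLike.congr_fun ℋ.S_t a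
        have h2 : 𝒦.S (𝒦.t a) = 𝒦.s a := DFunLike.congr_fun 𝒦.S_t a
        simp only [AlgHom.comp_apply, h1, h2, hs', ht'])
      (fun i j => by
        have hf : f.mapMatrix u = v := Matrix.ext huv
        have h1 : f.mapMatrix (ℋ.S.mapMatrix u) * v = 1 := by
          rw [← hf, ← map_mul, hu.S_mul, map_one]
        have h2 : 𝒦.S.mapMatrix v = f.mapMatrix (ℋ.S.mapMatrix u) :=
          left_inv_eq_right_inv hv.S_mul (mul_eq_one_comm.1 h1)
        rw [AlgHom.comp_apply, huv]
        exact congrFun (congrFun h2 i) j) }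

/-! ### The functor given by a multiplicative matrix -/

section

variable {A H : Type*} [CommRing A] [CommRing H] [Algebra ℂ A] [Algebra ℂ H]
  {ℋ : HopfAlgebroid ℂ A H} {u : Matrix (Fin m) (Fin m) H}

/-- The invertible matrix `g (u i j)` at a point `g : H → ℂ`. -/
def glPoint (hu : ℋ.IsMultiplicative u) (g : H →ₐ[ℂ] ℂ) : GL (Fin m) ℂ :=
  Matrix.GeneralLinearGroup.mk'' (g.mapMatrix u)
    (by rw [← AlgHom.map_det]; exact hu.isUnit_det.map g)

theorem glPoint_apply (hu : ℋ.IsMultiplicative u) (g : H →ₐ[ℂ] ℂ) (i j : Fin m) :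
    hu.glPoint g i j = g (u i j) := rfl

theorem glPoint_id (hu : ℋ.IsMultiplicative u) (x : Pt ℋ ℂ) :
    hu.glPoint (Arr.id x).hom = 1 :=
  Matrix.GeneralLinearGroup.ext fun i j => by
    change x.pt (ℋ.ε (u i j)) = (1 : Matrix (Fin m) (Fin m) ℂ) i j
    rw [hu.ε_apply, Matrix.one_apply, Matrix.one_apply]; split_ifs <;> simp

theorem glPoint_comp (hu : ℋ.IsMultiplicative u) {x y z : Pt ℋ ℂ} (f : Arr x y) (g : Arr y z) :
    hu.glPoint (f.comp g).hom = hu.glPoint g.hom * hu.glPoint f.hom :=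
  Matrix.GeneralLinearGroup.ext fun i j => by
    change Amalg.lift g.hom f.hom (Arr.composable f g) (ℋ.Δ (u i j)) =
      (g.hom.mapMatrix u * f.hom.mapMatrix u) i j
    simp only [hu.Δ_apply, map_sum, map_mul, lift_inl, lift_inr, Matrix.mul_apply]
    rfl

/-- The functor to `𝔸¹ × GL_m(ℂ) × 𝔸¹` given by a multiplicative matrix and a coordinate function
`c` on the objects. -/
def toInducedGL (hu : ℋ.IsMultiplicative u) (c : A) :
    CategoryTheory.Functor (Pt ℋ ℂ) (InducedGL m) where
  obj x := ⟨x.pt c⟩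
  map g := ⟨hu.glPoint g.hom⟩
  map_id x := InducedGL.Arr.ext (hu.glPoint_id x)
  map_comp f g := InducedGL.Arr.ext (hu.glPoint_comp f g)

/-- The matrix representation of the isotropy group of `x`. -/
def isotropyRep (hu : ℋ.IsMultiplicative u) (x : Pt ℋ ℂ) :
    CategoryTheory.Aut x →* GL (Fin m) ℂ where
  toFun g := hu.glPoint g.hom.hom
  map_one' := hu.glPoint_id x
  map_mul' g h := hu.glPoint_comp h.hom g.hom

theorem arr_ext (hu : ℋ.IsMultiplicative u) (hG : Generates ℋ.s ℋ.t u) {x y : Pt ℋ ℂ}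
    {f g : Arr x y} (h : hu.glPoint f.hom = hu.glPoint g.hom) : f = g :=
  Arr.ext <| hG.ext (fun a => DFunLike.congr_fun (f.tgt.trans g.tgt.symm) a)
    (fun a => DFunLike.congr_fun (f.src.trans g.src.symm) a)
    fun i j => by rw [← hu.glPoint_apply, h, hu.glPoint_apply]

theorem faithful_toInducedGL (hu : ℋ.IsMultiplicative u) (hG : Generates ℋ.s ℋ.t u) (c : A) :
    (hu.toInducedGL c).Faithful where
  map_injective h := hu.arr_ext hG (congrArg InducedGL.Arr.mat h)

theorem isotropyRep_injective (hu : ℋ.IsMultiplicative u) (hG : Generates ℋ.s ℋ.t u)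
    (x : Pt ℋ ℂ) : Function.Injective (hu.isotropyRep x) :=
  fun _ _ h => CategoryTheory.Iso.ext (hu.arr_ext hG h)

end

theorem bijective_toInducedGL_obj {H : Type*} [CommRing H] [Algebra ℂ H]
    {ℋ : HopfAlgebroid ℂ ℂ[X] H} {u : Matrix (Fin m) (Fin m) H} (hu : ℋ.IsMultiplicative u) :
    Function.Bijective (hu.toInducedGL Polynomial.X).obj :=
  ⟨fun _ _ h => Pt.ext (Polynomial.algHom_ext (congrArg InducedGL.pt h)),
    fun p => ⟨⟨Polynomial.aeval p.pt⟩, InducedGL.ext (Polynomial.aeval_X p.pt)⟩⟩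

end IsMultiplicative

end HopfAlgebroid

/-! ### The morphism from the coordinate ring of the linear groupoid -/

namespace GLRing

variable {m : ℕ}

theorem isMultiplicative_X (m : ℕ) : (hopf m).IsMultiplicative (X m) where
  ε_apply :=
    lift_X (AlgHom.id ℂ ℂ[X]) (AlgHom.id ℂ ℂ[X]) 1 (by rw [Matrix.det_one]; exact isUnit_one)
  Δ_apply i j := by
    have hdet : IsUnit ((Amalg.inl (t m) (s m)).mapMatrix (X m) *
        (Amalg.inr (t m) (s m)).mapMatrix (X m)).det := by
      rw [Matrix.det_mul, ← AlgHom.map_det, ← AlgHom.map_det]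
      exact (isUnit_det.map _).mul (isUnit_det.map _)
    refine (lift_X (R := Amalg (t m) (s m)) ((Amalg.inl (t m) (s m)).comp (s m))
      ((Amalg.inr (t m) (s m)).comp (t m)) _ hdet i j).trans ?_
    rw [Matrix.mul_apply]; rfl

/-- Every element of `(A ⊗ A)[X_ij, det⁻¹]` becomes a polynomial after multiplication by a unit. -/
theorem exists_mul_unit_eq (z : GLRing m) :
    ∃ (w : GLRing m) (p : MatPoly m), IsUnit w ∧ z * w = ofPolyRing m p := by
  obtain ⟨⟨p, d⟩, h⟩ := IsLocalization.surj (Submonoid.powers (genericMat m).det) z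
  exact ⟨_, p, IsLocalization.map_units (GLRing m) d, h⟩

theorem polyLift_eq_eval (x y : ℂ[X] →ₐ[ℂ] ℂ) (a : Matrix (Fin m) (Fin m) ℂ) (p : MatPoly m) :
    polyLift x y a p = MvPolynomial.eval (fun ij => a ij.1 ij.2) (MvPolynomial.map
      (Algebra.TensorProduct.lift x y fun _ _ => Commute.all _ _ : ℂ[X] ⊗[ℂ] ℂ[X] →ₐ[ℂ] ℂ).toRingHom
      p) := by
  rw [MvPolynomial.eval_map]; rfl

end GLRing

namespace galoisAlg

variable {M : DiffMod} {m : ℕ} (e : Module.Basis (Fin m) ℂ[X] M)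

theorem isMultiplicative_u : (hopf e).IsMultiplicative (u e) where
  ε_apply i j := by
    refine (FinDual.ε_cls (e.coord i) (e j)).trans ?_
    rw [Module.Basis.coord_apply, Module.Basis.repr_self, Matrix.one_apply, Finsupp.single_apply]
    simp only [eq_comm]
  Δ_apply i j := incl₂_injective e <| by
    refine ((incl₂_Δ e _).trans (FinDual.Δ_cls e (e.coord i) (e j))).trans ?_
    refine ((map_sum (incl₂ e) _ _).trans (Finset.sum_congr rfl fun l _ => ?_)).symm
    exact (map_mul (incl₂ e) _ _).trans (congrArg₂ (· * ·) (incl₂_inl e _) (incl₂_inr e _))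

/-- The morphism `(A ⊗ A)[X_ij, det⁻¹] → U°_(M)`, `X_ij ↦ u_ij`. -/
def ofGLRing : HopfAlgebroid.Hom (GLRing.hopf m) (hopf e) :=
  (GLRing.isMultiplicative_X m).homOfGenerates (isMultiplicative_u e) (GLRing.generates m)
    (GLRing.lift (s e) (t e) (u e) (isMultiplicative_u e).isUnit_det)
    (AlgHom.ext fun a => GLRing.lift_s (s e) (t e) (u e) (isMultiplicative_u e).isUnit_det a)
    (AlgHom.ext fun a => GLRing.lift_t (s e) (t e) (u e) (isMultiplicative_u e).isUnit_det a)
    (fun i j => GLRing.lift_X (s e) (t e) (u e) (isMultiplicative_u e).isUnit_det i j)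

theorem ofGLRing_s (a : ℂ[X]) : (ofGLRing e).toAlgHom (GLRing.s m a) = s e a :=
  GLRing.lift_s (s e) (t e) (u e) (isMultiplicative_u e).isUnit_det a

theorem ofGLRing_t (a : ℂ[X]) : (ofGLRing e).toAlgHom (GLRing.t m a) = t e a :=
  GLRing.lift_t (s e) (t e) (u e) (isMultiplicative_u e).isUnit_det a

theorem ofGLRing_X (i j : Fin m) : (ofGLRing e).toAlgHom (GLRing.X m i j) = u e i j :=
  GLRing.lift_X (s e) (t e) (u e) (isMultiplicative_u e).isUnit_det i j

theorem ofGLRing_surjective : Function.Surjective (ofGLRing e).toAlgHom := by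
  rw [← AlgHom.range_eq_top]
  refine generates e _ (fun a => ⟨_, ofGLRing_s e a⟩) (fun a => ⟨_, ofGLRing_t e a⟩)
    (fun i j => ⟨_, ofGLRing_X e i j⟩) fun x hx => ?_
  -- The inverse of `det u` is unique, so it is the image of the inverse of `det X`.
  obtain ⟨w, hw⟩ := GLRing.isUnit_det (m := m)
  have hdet : (ofGLRing e).toAlgHom (w : GLRing m) = (u e).det := by
    rw [hw, AlgHom.map_det]
    exact congrArg Matrix.det (Matrix.ext (ofGLRing_X e))
  refine ⟨(↑w⁻¹ : GLRing m), (left_inv_eq_right_inv hx ?_).symm⟩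
  change (u e).det * (ofGLRing e).toAlgHom (↑w⁻¹ : GLRing m) = 1
  rw [← hdet, ← map_mul, w.mul_inv, map_one]

/-! ### Closedness of the isotropy groups -/

/-- An invertible matrix is the matrix of an arrow `x → x` if and only if it satisfies the relations
between the `u_ij`, that is, if evaluation at it kills the polynomials killed by `Φ_M`. -/
theorem mem_range_isotropyRep_iff (x : HopfAlgebroid.Pt (hopf e) ℂ) (a : GL (Fin m) ℂ) :
    a ∈ ((isMultiplicative_u e).isotropyRep x).range ↔
      ∀ p : MatPoly m, (ofGLRing e).toAlgHom (GLRing.ofPolyRing m p) = 0 →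
        GLRing.polyLift x.pt x.pt (a : Matrix (Fin m) (Fin m) ℂ) p = 0 := by
  have ha : IsUnit (a : Matrix (Fin m) (Fin m) ℂ).det := (Matrix.isUnit_iff_isUnit_det _).1 a.isUnit
  constructor
  · rintro ⟨g, rfl⟩ p hp
    have h : GLRing.lift x.pt x.pt _ ha = g.hom.hom.comp (ofGLRing e).toAlgHom :=
      (GLRing.generates m).ext
        (fun b => by
          rw [GLRing.lift_s, AlgHom.comp_apply, ofGLRing_s]
          exact (DFunLike.congr_fun g.hom.tgt b).symm)
        (fun b => by
          rw [GLRing.lift_t, AlgHom.comp_apply, ofGLRing_t]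
          exact (DFunLike.congr_fun g.hom.src b).symm)
        (fun i j => by rw [GLRing.lift_X, AlgHom.comp_apply, ofGLRing_X]; rfl)
    rw [← GLRing.lift_ofPolyRing _ _ _ ha, h, AlgHom.comp_apply, hp, map_zero]
  · intro h
    let q := GLRing.lift x.pt x.pt (a : Matrix (Fin m) (Fin m) ℂ) ha
    have hker : ∀ z, (ofGLRing e).toAlgHom z = 0 → q z = 0 := fun z hz => by
      obtain ⟨w, p, hw, hwp⟩ := GLRing.exists_mul_unit_eq z
      have h1 : q (GLRing.ofPolyRing m p) = 0 :=
        (GLRing.lift_ofPolyRing _ _ _ ha p).trans (h p (by rw [← hwp, map_mul, hz, zero_mul]))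
      rw [← hwp, map_mul] at h1
      exact (hw.map q).mul_left_eq_zero.1 h1
    let g : galoisAlg e →ₐ[ℂ] ℂ := AlgHom.liftOfSurjective (ofGLRing e).toAlgHom
      (ofGLRing_surjective e) q hker
    have hg (z : GLRing m) : g ((ofGLRing e).toAlgHom z) = q z :=
      AlgHom.liftOfSurjective_apply _ _ _ _ z
    let r : x ⟶ x :=
      { hom := g
        src := AlgHom.ext fun b => by
          refine (congrArg g (ofGLRing_t e b)).symm.trans ((hg _).trans ?_)
          exact GLRing.lift_t _ _ _ ha b
        tgt := AlgHom.ext fun b => by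
          refine (congrArg g (ofGLRing_s e b)).symm.trans ((hg _).trans ?_)
          exact GLRing.lift_s _ _ _ ha b }
    refine ⟨(CategoryTheory.Groupoid.isoEquivHom x x).symm r, ?_⟩
    refine Matrix.GeneralLinearGroup.ext fun i j => ?_
    change g (u e i j) = a i j
    rw [← ofGLRing_X, hg]
    exact GLRing.lift_X _ _ _ ha i j

theorem isZariskiClosed_range_isotropyRep (x : HopfAlgebroid.Pt (hopf e) ℂ) :
    IsZariskiClosed (((isMultiplicative_u e).isotropyRep x).range : Set (GL (Fin m) ℂ)) := by
  refine ⟨MvPolynomial.map (Algebra.TensorProduct.lift x.pt x.pt fun _ _ => Commute.all _ _ :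
    ℂ[X] ⊗[ℂ] ℂ[X] →ₐ[ℂ] ℂ).toRingHom ''
      {p | (ofGLRing e).toAlgHom (GLRing.ofPolyRing m p) = 0}, Set.ext fun a => ?_⟩
  simp only [SetLike.mem_coe, mem_range_isotropyRep_iff, Set.mem_ofPred_eq, Set.forall_mem_image,
    GLRing.polyLift_eq_eval]

end galoisAlg

end DiffGalois

end

theorem corollary5p10 (M : DiffGalois.DiffMod) (m : ℕ) (e : Module.Basis (Fin m) ℂ[X] M) :
    ∃ Φ : DiffGalois.HopfAlgebroid.Hom (DiffGalois.GLRing.hopf m) (DiffGalois.galoisAlg.hopf e),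
      (∀ i j, Φ.toAlgHom (DiffGalois.GLRing.X m i j) = DiffGalois.galoisAlg.u e i j) ∧
      Function.Surjective Φ.toAlgHom ∧
      ∃ F : CategoryTheory.Functor (DiffGalois.HopfAlgebroid.Pt (DiffGalois.galoisAlg.hopf e) ℂ)
          (DiffGalois.InducedGL m),
        (∀ x, (F.obj x).pt = x.pt Polynomial.X) ∧
        (∀ (x y : DiffGalois.HopfAlgebroid.Pt (DiffGalois.galoisAlg.hopf e) ℂ) (g : x ⟶ y)
          (i j : Fin m), (F.map g).mat i j = g.hom (Φ.toAlgHom (DiffGalois.GLRing.X m i j))) ∧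
        Function.Bijective F.obj ∧
        F.Faithful ∧
        ∀ x : DiffGalois.HopfAlgebroid.Pt (DiffGalois.galoisAlg.hopf e) ℂ,
          ∃ G : Subgroup (Matrix.GeneralLinearGroup (Fin m) ℂ), DiffGalois.IsZariskiClosed (G : Set (Matrix.GeneralLinearGroup (Fin m) ℂ)) ∧
            ∃ ρ : CategoryTheory.Aut x ≃* G,
              ∀ g : CategoryTheory.Aut x, (ρ g : Matrix.GeneralLinearGroup (Fin m) ℂ) = (F.map g.hom).mat := by
  have hu := DiffGalois.galoisAlg.isMultiplicative_u e
  have hG := DiffGalois.galoisAlg.generates e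
  refine ⟨DiffGalois.galoisAlg.ofGLRing e, DiffGalois.galoisAlg.ofGLRing_X e,
    DiffGalois.galoisAlg.ofGLRing_surjective e, hu.toInducedGL Polynomial.X, fun _ => rfl,
    fun x y g i j => ?_, hu.bijective_toInducedGL_obj, hu.faithful_toInducedGL hG _,
    fun x => ⟨(hu.isotropyRep x).range,
      DiffGalois.galoisAlg.isZariskiClosed_range_isotropyRep e x,
      MonoidHom.ofInjective (hu.isotropyRep_injective hG x), fun _ => rfl⟩⟩
  rw [DiffGalois.galoisAlg.ofGLRing_X]
  rfl
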